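/- A $\Gamma$-tree is a map $T$ from a finite, non-empty, prefix-closed set of nodes in $\{l,r\}^*$ to $\Gamma\cup\{\bot\}$ with $T(w)=\bot$ if and only if $w$ is the empty word $\lambda$ (the root). A deterministic tree-walking-storage automaton (TWSDA) has a finite set $Q$ of states, an initial state, a set of accepting states, a finite input alphabet $\Sigma$, an endmarker $\rhd\notin\Sigma$, a finite set $\Gamma$ of tree symbols, a root symbol $\bot\notin\Gamma$, and a partial transition function $\delta$. From the current state, an input $a\in\Sigma\cup\{\lambda,\rhd\}$, the type of the current tree node (whether it is the root, a left or a right descendant, and whether it has a left and whether it has a right descendant) and the label of that node, $\delta$ determines a new state and one of the following operations: move the tree pointer up, do not move it, move it to the left or to the right descendant, pop the current node if it is a leaf other than the root (the pointer moves up), or push a new left or right descendant with a label from $\Gamma$ (the pointer moves to it). The function $\delta$ never moves the pointer to a non-existing node, never pops a non-leaf or the root and never pushes an existing descendant; and if $\delta$ is defined for $\lambda$ input on some state, type and label, then it is undefined there for all $a\in\Sigma\cup\{\rhd\}$. The computation on $w\in\Sigma^*$ starts in the initial state with the input $w\rhd$ and the tree that consists of the root only; $w$ is accepted if the automaton halts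 ($\delta$ is undefined for the current configuration) in an accepting state after having read $w\rhd$ entirely. The automaton is non-erasing (TWSDNEA) if it never pops, and it works in real time if $\delta$ is undefined for $\lambda$ input. Let $\mathscr{L}_{rt}(\mathrm{TWSDA})$ and $\mathscr{L}_{rt}(\mathrm{TWSDNEA})$ be the families of languages accepted by TWSDAs, respectively by TWSDNEAs, that work in real time. Two families of languages are incomparable if neither of them is a subset of the other. Let $h\colon\{\alpha_0,\alpha_1,\alpha_2,\alpha_3\}^*\to\{a,b\}^*$ be the homomorphism with $h(\alpha_0)=aa$, $h(\alpha_1)=ab$, $h(\alpha_2)=ba$, $h(\alpha_3)=bb$, and let $$L_h=\{\,x_1\$x_2\$\cdots\$x_k\# y \mid k\ge 0,\ x_i\in\{a,b\}^* \text{ for } 1\le i\le k,\ y\in\{\alpha_0,\alpha_1,\alpha_2,\alpha_3\}^*,\ \text{and there is a } j \text{ with } x_j^R=h(y)\,\},$$ where $x^R$ is the reversal of $x$. Let $L_{\mathrm{fib}}=\{\,a^{2n}\mid n \text{ is a Fibonacci number}\,\}$, where the Fibonacci numbers are $1,1,2,3,5,8,\dots$ **Theorem.** Each of the families $\mathscr{L}_{rt}(\mathrm{TWSDA})$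 and $\mathscr{L}_{rt}(\mathrm{TWSDNEA})$ is incomparable with the family of context-free languages. More precisely, $L_h$ is context-free but belongs to neither $\mathscr{L}_{rt}(\mathrm{TWSDA})$ nor $\mathscr{L}_{rt}(\mathrm{TWSDNEA})$, while the unary language $L_{\mathrm{fib}}$ belongs to both $\mathscr{L}_{rt}(\mathrm{TWSDA})$ and $\mathscr{L}_{rt}(\mathrm{TWSDNEA})$, the set $\{\,m \mid a^m\in L_{\mathrm{fib}}\,\}$ is not semilinear, and $L_{\mathrm{fib}}$ is not context-free. -/

import Mathlib

/-! ### Trees labelled by a finite alphabet -/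

/-- The two sides on which a node of a binary tree can have a descendant. -/
inductive Side where
  | left
  | right
  deriving DecidableEq

/-- A node is addressed by the word over `{l, r}` that leads to it from the root, written with
its last letter first: the root is `[]`, and the `d`-descendant of the node `P` is `d :: P`. -/
abbrev Node := List Side

/-- A tree with tree symbols from `Γ`: a partial map from a finite, non-empty, prefix-closed set of
nodes to `Γ ∪ {⊥}` that takes the value `⊥` exactly at the root. The value `none` means that
the node does not exist. (Words are written backwards, hence removing the last letter of a word
is removing the head of the list; that the root exists follows from the last field.) -/
structure GammaTree (Γ : Type) where
  label : Node → Option (WithBot Γ)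
  finite_nodes : {w | label w ≠ none}.Finite
  prefix_closed : ∀ (d : Side) (w : Node), label (d :: w) ≠ none → label w ≠ none
  label_eq_bot_iff : ∀ w : Node, label w = some ⊥ ↔ w = []

/-- The type of a node: whether it is the root (`none`), a left or a right descendant, and
whether it has a left and whether it has a right descendant. -/
structure NodeType where
  position : Option Side
  hasLeft : Bool
  hasRight : Bool

/-- Whether a node of type `t` has a descendant on side `d`. -/
def NodeType.has (t : NodeType) : Side → Bool
  | .left => t.hasLeft
  | .right => t.hasRight

namespace GammaTree

variable {Γ : Type}

/-- The type of the node `P` in the tree `T`. -/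
def typeAt (T : GammaTree Γ) (P : Node) : NodeType where
  position := P.head?
  hasLeft := (T.label (.left :: P)).isSome
  hasRight := (T.label (.right :: P)).isSome

/-- The tree that consists of its root only. -/
def single (Γ : Type) : GammaTree Γ where
  label w := if w = [] then some ⊥ else none
  finite_nodes := (Set.finite_singleton ([] : Node)).subset (by
    intro w hw
    by_contra h
    exact hw (if_neg h))
  prefix_closed := by
    intro d w h
    simp at h
  label_eq_bot_iff := by
    intro w
    by_cases h : w = [] <;> simp [h]

end GammaTree

/-! ### Tree-walking-storage automata -/

/-- The operations on the tree-storage: moving the tree pointer up, not moving it, moving it to the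
left or right descendant, removing the current leaf, and appending a new left or right
descendant that is labelled by a tree symbol. -/
inductive StorageOp (Γ : Type) where
  | up
  | stay
  | down (d : Side)
  | pop
  | push (x : Γ) (d : Side)

namespace StorageOp

variable {Γ : Type}

/-- The operation can be carried out at a node of type `t`. -/
def Legal (t : NodeType) : StorageOp Γ → Prop
  | up => t.position ≠ none
  | stay => True
  | down d => t.has d = true
  | pop => t.position ≠ none ∧ t.hasLeft = false ∧ t.hasRight = false
  | push _ d => t.has d = false

/-- `op.Performs T P T' P'`: the operation `op` turns the tree `T` with tree pointer `P` into the
tree `T'` with tree pointer `P'`. -/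
def Performs (T : GammaTree Γ) (P : Node) (T' : GammaTree Γ) (P' : Node) : StorageOp Γ → Prop
  | up => (∃ d, P = d :: P') ∧ T' = T
  | stay => P' = P ∧ T' = T
  | down d => P' = d :: P ∧ T.label (d :: P) ≠ none ∧ T' = T
  | pop => (∃ d, P = d :: P') ∧ T.label (.left :: P) = none ∧ T.label (.right :: P) = none ∧
      T'.label = Function.update T.label P none
  | push x d => P' = d :: P ∧ T.label (d :: P) = none ∧
      T'.label = Function.update T.label (d :: P) (some (x : WithBot Γ))

end StorageOp

/-- The symbols on the input tape: the input symbols and the endmarker. -/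
inductive TapeSymbol (A : Type) where
  | sym (a : A)
  | endmarker

/-- Deterministic tree-walking-storage automata with input alphabet `A`. The second argument of the
partial transition function `δ` is `none` for `λ` input. -/
structure TWSDA (A : Type) where
  Q : Type
  Γ : Type
  finite_Q : Finite Q
  finite_Γ : Finite Γ
  δ : Q → Option (TapeSymbol A) → NodeType → WithBot Γ → Option (Q × StorageOp Γ)
  start : Q
  accepting : Set Q
  /-- There is never a choice of using an input symbol or of using `λ` input. -/
  no_choice : ∀ q t x, δ q none t x ≠ none → ∀ a : TapeSymbol A, δ q (some a) t x = none
  /-- The pointer is never moved to a non-existing node, only leaves other than the root are popped,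
  and no existing descendant is pushed. -/
  legal : ∀ q a t x q' op, δ q a t x = some (q', op) → op.Legal t

namespace TWSDA

variable {A : Type}

/-- A configuration: the state, the unread part of the input (including the endmarker), the
tree-storage, and the tree pointer. -/
structure Config (M : TWSDA A) where
  state : M.Q
  unread : List (TapeSymbol A)
  tree : GammaTree M.Γ
  pointer : Node

/-- The initial configuration for the input `w`. -/
def init (M : TWSDA A) (w : List A) : M.Config where
  state := M.start
  unread := w.map TapeSymbol.sym ++ [TapeSymbol.endmarker]
  tree := GammaTree.single M.Γ
  pointer := []

/-- One step of the computation. It consumes `a`, which is the first unread symbol or `λ`. -/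
def Step (M : TWSDA A) (c c' : M.Config) : Prop :=
  ∃ (a : Option (TapeSymbol A)) (x : WithBot M.Γ) (op : StorageOp M.Γ),
    c.unread = a.toList ++ c'.unread ∧
    c.tree.label c.pointer = some x ∧
    M.δ c.state a (c.tree.typeAt c.pointer) x = some (c'.state, op) ∧
    op.Performs c.tree c.pointer c'.tree c'.pointer

/-- The automaton halts: the transition function is not defined for the current configuration,
neither for the first unread symbol nor for `λ`. -/
def Halted (M : TWSDA A) (c : M.Config) : Prop :=
  ∀ (a : Option (TapeSymbol A)) (v : List (TapeSymbol A)) (x : WithBot M.Γ),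
    c.unread = a.toList ++ v → c.tree.label c.pointer = some x →
      M.δ c.state a (c.tree.typeAt c.pointer) x = none

/-- The automaton halts in an accepting state after having read the input `w` and the endmarker
entirely. -/
def Accepts (M : TWSDA A) (w : List A) : Prop :=
  ∃ c : M.Config, Relation.ReflTransGen M.Step (M.init w) c ∧
    M.Halted c ∧ c.unread = [] ∧ c.state ∈ M.accepting

/-- The language accepted by the automaton. -/
def language (M : TWSDA A) : Language A := {w | M.Accepts w}

/-- The automaton works in real time: its transition function is undefined for `λ` input. -/
def RealTime (M : TWSDA A) : Prop := ∀ q t x, M.δ q none t x = none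

/-- The automaton is non-erasing: it never pops from the tree. -/
def NonErasing (M : TWSDA A) : Prop := ∀ q a t x q', M.δ q a t x ≠ some (q', StorageOp.pop)

end TWSDA

/-! ### Families of languages -/

/-- A family of languages: a set of languages over every finite alphabet. -/
def LanguageFamily : Type 1 := (A : Type) → [Finite A] → Set (Language A)

/-- Inclusion of families of languages. -/
def LanguageFamily.IsSubfamily (F G : LanguageFamily) : Prop :=
  ∀ (A : Type) [Finite A], F A ⊆ G A

/-- Two families of languages are incomparable if neither is included in the other. -/
def LanguageFamily.Incomparable (F G : LanguageFamily) : Prop :=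
  ¬ F.IsSubfamily G ∧ ¬ G.IsSubfamily F

/-- The family of languages accepted by tree-walking-storage automata in real time. -/
def rtTWSDA : LanguageFamily := fun A _ => {L | ∃ M : TWSDA A, M.RealTime ∧ M.language = L}

/-- The family of languages accepted by non-erasing tree-walking-storage automata in real time. -/
def rtTWSDNEA : LanguageFamily := fun A _ =>
  {L | ∃ M : TWSDA A, M.NonErasing ∧ M.RealTime ∧ M.language = L}

/-- The family of context-free languages. -/
def contextFreeFamily : LanguageFamily := fun A _ => {L : Language A | L.IsContextFree}

/-! ### The witness languages -/

/-- The alphabet `{a, b}`. -/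
inductive AB where
  | a
  | b
  deriving DecidableEq

instance : Finite AB :=
  Finite.of_surjective (fun i : Bool => if i then AB.a else AB.b) (by
    intro c
    cases c
    · exact ⟨true, rfl⟩
    · exact ⟨false, rfl⟩)

/-- The alphabet `{a, b, $, #, α₀, α₁, α₂, α₃}`. -/
inductive HAlphabet where
  | letter (c : AB)
  | dollar
  | border
  | alpha (i : Fin 4)
  deriving DecidableEq

instance : Finite HAlphabet :=
  Finite.of_surjective (fun s : (AB ⊕ Fin 4) ⊕ Bool => match s with
    | .inl (.inl c) => HAlphabet.letter c
    | .inl (.inr i) => HAlphabet.alpha i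
    | .inr i => if i then HAlphabet.dollar else HAlphabet.border) (by
    intro c
    cases c with
    | letter c => exact ⟨.inl (.inl c), rfl⟩
    | dollar => exact ⟨.inr true, rfl⟩
    | border => exact ⟨.inr false, rfl⟩
    | alpha i => exact ⟨.inl (.inr i), rfl⟩)

/-- The images of the letters `α₀, α₁, α₂, α₃` under the homomorphism `h`. -/
def hLetter : Fin 4 → List AB :=
  ![[AB.a, AB.a], [AB.a, AB.b], [AB.b, AB.a], [AB.b, AB.b]]

/-- The homomorphism `h : {α₀, α₁, α₂, α₃}* → {a, b}*`. -/
def hHom (y : List (Fin 4)) : List AB := y.flatMap hLetter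

/-- The language `L_h` of the words `x₁ $ x₂ $ ⋯ $ xₖ # y` with `k ≥ 0` and `xᵢ ∈ {a, b}*` such that
some `xⱼ` satisfies `xⱼᴿ = h(y)`. -/
def Lh : Language HAlphabet :=
  {w | ∃ (xs : List (List AB)) (y : List (Fin 4)),
    (∃ x ∈ xs, x.reverse = hHom y) ∧
    w = List.intercalate [HAlphabet.dollar] (xs.map fun x => x.map HAlphabet.letter) ++
      [HAlphabet.border] ++ y.map HAlphabet.alpha}

/-- The language `{a^(2n) | n is a Fibonacci number}` over a one-letter alphabet, where the
Fibonacci numbers are `1, 1, 2, 3, 5, …`. -/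
def Lfib : Language Unit :=
  {w | ∃ i : ℕ, 1 ≤ i ∧ w = List.replicate (2 * Nat.fib i) ()}

/-! The two witnesses separate the families for unrelated reasons.

`Lh` is too hard for real time because little of the storage can still be used once `#` has been
read. With `m` letters of `y` and the endmarker left, only `m + 1` steps remain, so the outcome
depends only on the state and the part of the tree near the pointer (`Agree.moves`). In a binary
tree this local view is described by about `m ^ 2 * 2 ^ m` labels, while the prefix before `y` can
encode any set of words of length `m` over four letters, and there are `2 ^ 4 ^ m` such sets. For
large `m` two sets share a view (`exists_card_view_lt`), yet some `y` must be accepted after one and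
rejected after the other (`language_ne_Lh`). The homomorphism `h`, by packing two letters into one,
creates the gap between `2 ^ m` and `4 ^ m`. A grammar for `Lh` guesses the matching block and nests
it with `y`.

`Lfib` is easy in real time because a tree can be its own clock. `fibMachine` traverses its tree in
rounds. Each node receives its left descendant in the round after its own creation and its right
descendant one round later, so a subtree combines a left part one round younger and a right part two
rounds younger than itself. Round lengths therefore satisfy the Fibonacci recursion, and rounds
begin exactly at the times `2 * Nat.fib (k + 5)` (`exists_round`, `exists_at`); the smaller lengths
are handled by the finite control.

Finally, the word lengths of an infinite context-free language, like every infinite semilinear set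
of numbers, contain an infinite arithmetic progression (the two lemmas `exists_progression`). The
growing gaps between Fibonacci numbers exclude this (`fib_progression`). -/

/-! ### Parses of words by context-free grammars -/

namespace ContextFreeGrammar

variable {T : Type*} {g : ContextFreeGrammar T}

/-- `g.Parses n s w`: the word `w` is derived from the sentential form `s` by applying
`n` rules. -/
inductive Parses (g : ContextFreeGrammar T) : ℕ → List (Symbol T g.NT) → List T → Prop
  | nil : Parses g 0 [] []
  | terminal {n s w} (t : T) : Parses g n s w → Parses g n (.terminal t :: s) (t :: w)
  | rule {n m s u v} {r : ContextFreeRule T g.NT} : r ∈ g.rules → Parses g n r.output u →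
      Parses g m s v → Parses g (n + m + 1) (.nonterminal r.input :: s) (u ++ v)

theorem parses_map_terminal (w : List T) : g.Parses 0 (w.map .terminal) w := by
  induction w with
  | nil => exact .nil
  | cons t w ih => exact .terminal t ih

theorem Parses.derives {n : ℕ} {s : List (Symbol T g.NT)} {w : List T} (h : g.Parses n s w) :
    g.Derives s (w.map .terminal) := by
  induction h with
  | nil => exact Relation.ReflTransGen.refl
  | terminal t _ ih => exact ih.append_left [.terminal t]
  | @rule n m s u v r hr _ _ ih₁ ih₂ =>
    have h₁ : g.Derives (.nonterminal r.input :: s) (r.output ++ s) :=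
      Produces.single ⟨r, hr, .head s⟩
    rw [List.map_append]
    exact (h₁.trans (ih₁.append_right s)).trans (ih₂.append_left _)

theorem Parses.append {n m : ℕ} {s t : List (Symbol T g.NT)} {u v : List T}
    (h₁ : g.Parses n s u) (h₂ : g.Parses m t v) : g.Parses (n + m) (s ++ t) (u ++ v) := by
  induction h₁ with
  | nil => simpa using h₂
  | terminal t _ ih => exact .terminal t ih
  | @rule n₁ n₂ s' u' v' r hr h _ _ ih =>
    have := Parses.rule hr h ih
    rw [List.append_assoc, List.cons_append]
    convert this using 1
    omega

theorem Parses.split {t : List (Symbol T g.NT)} : ∀ {s : List (Symbol T g.NT)} {n : ℕ} {w : List T},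
    g.Parses n (s ++ t) w →
      ∃ n₁ n₂ u v, n = n₁ + n₂ ∧ w = u ++ v ∧ g.Parses n₁ s u ∧ g.Parses n₂ t v
  | [], n, w, h => ⟨0, n, [], w, by simp, rfl, .nil, h⟩
  | .terminal a :: s, n, _, .terminal _ h => by
    obtain ⟨n₁, n₂, u, v, hn, rfl, h₁, h₂⟩ := Parses.split h
    exact ⟨n₁, n₂, a :: u, v, hn, rfl, .terminal a h₁, h₂⟩
  | .nonterminal _ :: s, _, _, .rule (n := k) (u := x) hr h₀ h => by
    obtain ⟨n₁, n₂, u, v, rfl, rfl, h₁, h₂⟩ := Parses.split h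
    exact ⟨k + n₁ + 1, n₂, x ++ u, v, by omega, by simp, .rule hr h₀ h₁, h₂⟩

/-- Going backwards along the derivation, the parse of the rewritten form splits around the output
of the rule, and its middle piece is folded into one application of that rule. -/
theorem Derives.exists_parses {s : List (Symbol T g.NT)} {w : List T}
    (h : g.Derives s (w.map .terminal)) : ∃ n, g.Parses n s w := by
  induction h using Relation.ReflTransGen.head_induction_on with
  | refl => exact ⟨0, parses_map_terminal w⟩
  | head h _ ih =>
    obtain ⟨r, hr, h⟩ := h
    obtain ⟨p, q, rfl, rfl⟩ := h.exists_parts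
    obtain ⟨n, hn⟩ := ih
    obtain ⟨_, _, _, _, rfl, rfl, h₁, h₂⟩ := Parses.split hn
    obtain ⟨_, _, _, _, rfl, rfl, h₃, h₄⟩ := Parses.split h₁
    rw [List.append_assoc, List.append_assoc]
    exact ⟨_, h₃.append (.rule hr h₄ h₂)⟩

theorem mem_language_iff_parses {w : List T} :
    w ∈ g.language ↔ ∃ n, g.Parses n [.nonterminal g.initial] w :=
  ⟨Derives.exists_parses, fun ⟨_, h⟩ => h.derives⟩

theorem Parses.exists_rule {n : ℕ} {A : g.NT} {w : List T} (h : g.Parses n [.nonterminal A] w) :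
    ∃ r ∈ g.rules, r.input = A ∧ ∃ m < n, g.Parses m r.output w := by
  cases h with
  | @rule n m _ u v r hr h₁ h₂ =>
    cases h₂
    exact ⟨r, hr, rfl, n, by omega, by simpa using h₁⟩

/-- The language of a sentential form when the nonterminals are interpreted by `I`. -/
def interpret (I : g.NT → Language T) : List (Symbol T g.NT) → Language T
  | [] => 1
  | .terminal t :: s => {[t]} * interpret I s
  | .nonterminal A :: s => I A * interpret I s

/-- The derivable words are the least solution of the inequalities given by the rules, so any
solution `I` bounds them from above. This gives the soundness of the grammar for `Lh`. -/
theorem Parses.mem_interpret {I : g.NT → Language T}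
    (hI : ∀ r ∈ g.rules, interpret I r.output ≤ I r.input) {n : ℕ} {s : List (Symbol T g.NT)}
    {w : List T} (h : g.Parses n s w) : w ∈ interpret I s := by
  induction h with
  | nil => exact Language.nil_mem_one
  | terminal t _ ih => exact Language.append_mem_mul (a := [t]) rfl ih
  | rule hr _ _ ih₁ ih₂ => exact Language.append_mem_mul (hI _ hr ih₁) ih₂

/-! ### Contexts and the lengths of derived words -/

/-- `g.Context A B d`: from `A` one can derive a sentential form that consists of `B` and of
`d` terminals. -/
def Context (g : ContextFreeGrammar T) (A B : g.NT) (d : ℕ) : Prop :=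
  ∃ u v : List T, u.length + v.length = d ∧
    g.Derives [.nonterminal A] (u.map .terminal ++ [.nonterminal B] ++ v.map .terminal)

theorem Context.refl (A : g.NT) : g.Context A A 0 := ⟨[], [], rfl, Relation.ReflTransGen.refl⟩

theorem Context.trans {A B C : g.NT} {d e : ℕ} (h₁ : g.Context A B d) (h₂ : g.Context B C e) :
    g.Context A C (d + e) := by
  obtain ⟨u, v, rfl, h₁⟩ := h₁
  obtain ⟨u', v', rfl, h₂⟩ := h₂
  refine ⟨u ++ u', v' ++ v, by simp; omega, h₁.trans ?_⟩
  simpa using (h₂.append_left (u.map .terminal)).append_right (v.map .terminal)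

theorem Context.exists_length {A B : g.NT} {d n : ℕ} {w : List T} (h : g.Context A B d)
    (hw : g.Parses n [.nonterminal B] w) :
    ∃ w' : List T, w'.length = d + w.length ∧ g.Derives [.nonterminal A] (w'.map .terminal) := by
  obtain ⟨u, v, rfl, h⟩ := h
  refine ⟨u ++ w ++ v, by simp; omega, h.trans ?_⟩
  simpa using (hw.derives.append_left (u.map .terminal)).append_right (v.map .terminal)

theorem Parses.exists_context {n : ℕ} {r : ContextFreeRule T g.NT} (hr : r ∈ g.rules) {w : List T}
    (h : g.Parses n r.output w) {B : g.NT} (hB : .nonterminal B ∈ r.output) :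
    ∃ d m, ∃ w', m ≤ n ∧ d + w'.length = w.length ∧ g.Context r.input B d ∧
      g.Parses m [.nonterminal B] w' := by
  obtain ⟨s, t, hst⟩ := List.append_of_mem hB
  rw [hst, ← List.singleton_append] at h
  obtain ⟨n₁, _, u, _, rfl, rfl, h₁, h⟩ := Parses.split h
  obtain ⟨n₂, n₃, w', v, rfl, rfl, h₂, h₃⟩ := Parses.split h
  refine ⟨u.length + v.length, n₂, w', by omega, by simp; omega, ⟨u, v, rfl, ?_⟩, h₂⟩
  refine (Produces.single ⟨r, hr, .input_output⟩).trans ?_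
  rw [hst, ← List.singleton_append, ← List.append_assoc]
  exact ((h₁.derives.append_right _).append_right _).trans (h₃.derives.append_left _)

theorem Parses.length_le {b : ℕ} {n : ℕ} {s : List (Symbol T g.NT)} {w : List T}
    (h : g.Parses n s w)
    (hb : ∀ B, .nonterminal B ∈ s → ∀ n w, g.Parses n [.nonterminal B] w → w.length ≤ b) :
    w.length ≤ s.length * (b + 1) := by
  induction h with
  | nil => simp
  | terminal t _ ih =>
    have := ih fun B hB => hb B (by simp [hB])
    simp only [List.length_cons]
    nlinarith
  | rule hr h _ _ ih =>
    have h₁ := ih fun B hB => hb B (by simp [hB])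
    have h₂ := hb _ (by simp) _ _ (Parses.rule hr h .nil)
    simp only [List.length_cons, List.length_append, List.append_nil] at h₂ ⊢
    nlinarith

/-- The nonterminals with rules that occur in contexts of `A`. -/
def reach (g : ContextFreeGrammar T) (A : g.NT) : Set g.NT :=
  {B | B ∈ ContextFreeRule.input '' (g.rules : Set (ContextFreeRule T g.NT)) ∧
    ∃ d, g.Context A B d}

/-- The type of nonterminals may be infinite; only inputs of the finitely many rules are counted. -/
theorem finite_reach (A : g.NT) : (g.reach A).Finite :=
  (g.rules.finite_toSet.image _).subset fun _ h => h.1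

theorem reach_subset {A B : g.NT} {d : ℕ} (h : g.Context A B d) : g.reach B ⊆ g.reach A :=
  fun _ ⟨hC, _, h'⟩ => ⟨hC, _, h.trans h'⟩

/-- Induction on the number of nonterminals reachable from `A`. A child that reaches as many
nonterminals as its parent lies on a cycle with it; by `hg` the cycle produces no terminals, so
passing to the child loses no length. If all children reach fewer, the rule output has boundedly
many symbols, each of bounded yield. -/
theorem exists_length_le (hg : ∀ A d e, g.Context g.initial A e →
    (∃ n w, g.Parses n [.nonterminal A] w) → g.Context A A d → d = 0) (k : ℕ) :
    ∃ b, ∀ n A w d, (g.reach A).ncard < k → g.Context g.initial A d →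
      g.Parses n [.nonterminal A] w → w.length ≤ b := by
  induction k with
  | zero => exact ⟨0, by simp⟩
  | succ k ih =>
    obtain ⟨b, hb⟩ := ih
    refine ⟨(g.rules.sup fun r => r.output.length) * (b + 1), fun n => ?_⟩
    induction n using Nat.strong_induction_on with
    | _ n ih =>
      intro A w d hA hSA hw
      obtain ⟨r, hr, rfl, m, hm, hw'⟩ := hw.exists_rule
      by_cases h : ∃ B, .nonterminal B ∈ r.output ∧ k ≤ (g.reach B).ncard
      · obtain ⟨B, hB, hk⟩ := h
        obtain ⟨e, m', w', hm', hlen, hAB, hp⟩ := hw'.exists_context hr hB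
        have heq : g.reach B = g.reach r.input :=
          Set.eq_of_subset_of_ncard_le (reach_subset hAB) (by omega) (finite_reach _)
        have hmem : r.input ∈ g.reach B := by
          rw [heq]
          exact ⟨⟨r, hr, rfl⟩, 0, .refl _⟩
        obtain ⟨-, e', hBA⟩ := hmem
        -- The cycle through `B` has total length `e + e' = 0`, so `w'` is as long as `w` and has a
        -- parse with fewer rules.
        have := hg _ _ _ hSA ⟨n, w, hw⟩ (hAB.trans hBA)
        have h' := ih m' (by omega) B w' _ (by rw [heq]; exact hA) (hSA.trans hAB) hp
        omega
      · push Not at h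
        refine (hw'.length_le (b := b) fun B hB n w hp => ?_).trans
          (Nat.mul_le_mul_right _ (Finset.le_sup (f := fun r => r.output.length) hr))
        obtain ⟨e, _, _, _, _, hAB, _⟩ := hw'.exists_context hr hB
        exact hb n B w _ (h B hB) (hSA.trans hAB) hp

theorem Context.iterate {A : g.NT} {d : ℕ} (h : g.Context A A d) (k : ℕ) :
    g.Context A A (k * d) := by
  induction k with
  | zero => simpa using Context.refl A
  | succ k ih => simpa [Nat.succ_mul] using ih.trans h

end ContextFreeGrammar

/-- The word lengths of an infinite context-free language contain an infinite arithmetic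
progression. -/
theorem Language.IsContextFree.exists_progression {T : Type*} {L : Language T}
    (hL : L.IsContextFree) (h : ∀ b, ∃ w ∈ L, b < w.length) :
    ∃ c d, 0 < d ∧ ∀ k, ∃ w ∈ L, w.length = c + k * d := by
  obtain ⟨g, rfl⟩ := hL
  by_contra hno
  have hg : ∀ A d e, g.Context g.initial A e →
      (∃ n w, g.Parses n [.nonterminal A] w) → g.Context A A d → d = 0 := by
    intro A d e hSA ⟨n, w, hw⟩ hAA
    by_contra hd
    -- A productive reachable cycle with `d > 0` can be iterated, and its iterates give the excluded
    -- progression.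
    refine hno ⟨e + w.length, d, Nat.pos_of_ne_zero hd, fun k => ?_⟩
    obtain ⟨w', hw', hder⟩ := (hSA.trans (hAA.iterate k)).exists_length hw
    exact ⟨w', hder, by omega⟩
  obtain ⟨b, hb⟩ := ContextFreeGrammar.exists_length_le hg ((g.reach g.initial).ncard + 1)
  obtain ⟨w, hw, hlt⟩ := h b
  obtain ⟨n, hn⟩ := ContextFreeGrammar.mem_language_iff_parses.1 hw
  have := hb n _ w 0 (Nat.lt_succ_self _) (.refl _) hn
  omega
/-! ### The language `L_h` is context-free -/

theorem List.intercalate_append {α : Type*} (s : List α) {l₁ l₂ : List (List α)} (h₁ : l₁ ≠ [])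
    (h₂ : l₂ ≠ []) :
    s.intercalate (l₁ ++ l₂) = s.intercalate l₁ ++ (s ++ s.intercalate l₂) := by
  induction l₁ with
  | nil => exact absurd rfl h₁
  | cons x l ih =>
    cases l with
    | nil =>
      obtain ⟨y, l₂, rfl⟩ := List.exists_cons_of_ne_nil h₂
      simp [List.intercalate, List.intersperse]
    | cons z l =>
      have := ih (by simp)
      simp only [List.intercalate, List.cons_append, List.intersperse, List.flatten_cons] at this ⊢
      rw [this]
      simp

/-- A letter or the separator `$`. -/
def HAlphabet.IsBlock : HAlphabet → Prop
  | letter _ => True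
  | dollar => True
  | _ => False

/-- The word `x₁ $ x₂ $ ⋯ $ xₖ`. -/
def blocks (xs : List (List AB)) : List HAlphabet :=
  List.intercalate [HAlphabet.dollar] (xs.map fun x => x.map HAlphabet.letter)

theorem blocks_singleton (x : List AB) : blocks [x] = x.map HAlphabet.letter := by
  simp [blocks, List.intercalate]

theorem blocks_append {xs ys : List (List AB)} (hx : xs ≠ []) (hy : ys ≠ []) :
    blocks (xs ++ ys) = blocks xs ++ .dollar :: blocks ys := by
  rw [blocks, List.map_append, List.intercalate_append _ (by simpa using hx) (by simpa using hy)]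
  rfl

theorem blocks_cons (x : List AB) {xs : List (List AB)} (hxs : xs ≠ []) :
    blocks (x :: xs) = x.map HAlphabet.letter ++ .dollar :: blocks xs := by
  rw [← List.singleton_append, blocks_append (by simp) hxs, blocks_singleton]

theorem isBlock_of_mem_blocks {xs : List (List AB)} {s : HAlphabet} (h : s ∈ blocks xs) :
    s.IsBlock := by
  induction xs with
  | nil => simp [blocks, List.intercalate] at h
  | cons x xs ih =>
    rcases eq_or_ne xs [] with rfl | hxs
    · rw [blocks_singleton] at h
      obtain ⟨c, -, rfl⟩ := List.mem_map.1 h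
      trivial
    · rw [blocks_cons x hxs] at h
      simp only [List.mem_append, List.mem_map, List.mem_cons] at h
      rcases h with ⟨c, -, rfl⟩ | rfl | h
      · trivial
      · trivial
      · exact ih h

/-- The empty word comes from the list `[[]]`. Since `blocks []` is empty as well, nonemptiness is
tracked throughout to make the decomposition unique. -/
theorem exists_eq_blocks {v : List HAlphabet} (h : ∀ s ∈ v, s.IsBlock) :
    ∃ xs, xs ≠ [] ∧ v = blocks xs := by
  induction v with
  | nil => exact ⟨[[]], by simp, by simp [blocks_singleton]⟩
  | cons s v ih =>
    obtain ⟨xs, hxs, rfl⟩ := ih fun s hs => h s (by simp [hs])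
    have hs := h s (by simp)
    cases s with
    | letter c =>
      obtain ⟨x, xs, rfl⟩ := List.exists_cons_of_ne_nil hxs
      refine ⟨(c :: x) :: xs, by simp, ?_⟩
      rcases eq_or_ne xs [] with rfl | hxs
      · simp [blocks_singleton]
      · simp [blocks_cons _ hxs]
    | dollar => exact ⟨[] :: xs, by simp, by simp [blocks_cons _ hxs]⟩
    | border => exact hs.elim
    | alpha i => exact hs.elim

/-! ### A grammar for `L_h` -/

/-- The nonterminals of a grammar for `L_h`. -/
inductive LhNT where
  | start
  | skip
  | pair
  | mid
  | tail
  deriving DecidableEq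

namespace LhNT

/-- The words that are skipped after the matching block, including the border. -/
def tailLang : Language HAlphabet :=
  {w | ∃ v : List HAlphabet, (∀ s ∈ v, s.IsBlock) ∧ w = v ++ [.border]}

/-- The words between the two matching parts. -/
def midLang : Language HAlphabet :=
  {w | w = [.border] ∨ ∃ v ∈ tailLang, w = .dollar :: v}

/-- The words of `L_h` whose first block matches. -/
def pairLang : Language HAlphabet :=
  {w | ∃ (y : List (Fin 4)) (n : List HAlphabet), n ∈ midLang ∧
    w = (hHom y).reverse.map .letter ++ n ++ y.map .alpha}

/-- The words in which a word with matching first block follows other blocks. -/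
def skipLang : Language HAlphabet :=
  {w | ∃ v m : List HAlphabet, (∀ s ∈ v, s.IsBlock) ∧ m ∈ pairLang ∧ w = v ++ .dollar :: m}

/-- The language of a nonterminal. -/
def lang : LhNT → Language HAlphabet
  | tail => tailLang
  | mid => midLang
  | pair => pairLang
  | skip => skipLang
  | start => {w | w ∈ pairLang ∨ w ∈ skipLang}

open Symbol in
/-- The rules of the grammar for `L_h`. -/
def ruleList : List (ContextFreeRule HAlphabet LhNT) :=
  [⟨start, [nonterminal pair]⟩, ⟨start, [nonterminal skip]⟩,
    ⟨skip, [terminal .dollar, nonterminal start]⟩, ⟨pair, [nonterminal mid]⟩,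
    ⟨mid, [terminal .border]⟩, ⟨mid, [terminal .dollar, nonterminal tail]⟩,
    ⟨tail, [terminal .border]⟩, ⟨tail, [terminal .dollar, nonterminal tail]⟩] ++
  [AB.a, AB.b].map (fun c => ⟨skip, [terminal (.letter c), nonterminal skip]⟩) ++
  [AB.a, AB.b].map (fun c => ⟨tail, [terminal (.letter c), nonterminal tail]⟩) ++
  (List.finRange 4).map (fun i => ⟨pair, (hLetter i).reverse.map (fun c => terminal (.letter c)) ++
    [nonterminal pair, terminal (.alpha i)]⟩)

/-- The grammar for `L_h`. -/
abbrev grammar : ContextFreeGrammar HAlphabet where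
  NT := LhNT
  initial := start
  rules := ruleList.toFinset

theorem hHom_concat (y : List (Fin 4)) (i : Fin 4) : hHom (y ++ [i]) = hHom y ++ hLetter i := by
  simp [hHom]

theorem mem_singleton_mul {t : HAlphabet} {L : Language HAlphabet} {w : List HAlphabet} :
    w ∈ ({[t]} : Language HAlphabet) * L ↔ ∃ v ∈ L, w = t :: v := by
  rw [Language.mem_mul]
  constructor
  · rintro ⟨_, rfl, v, hv, rfl⟩
    exact ⟨v, hv, rfl⟩
  · rintro ⟨v, hv, rfl⟩
    exact ⟨[t], rfl, v, hv, rfl⟩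

theorem interpret_terminals (I : grammar.NT → Language HAlphabet) (x : List AB)
    {s : List (Symbol HAlphabet grammar.NT)} {w : List HAlphabet}
    (h : w ∈ ContextFreeGrammar.interpret (g := grammar) I
      (x.map (fun c => .terminal (.letter c)) ++ s)) :
    ∃ v ∈ ContextFreeGrammar.interpret (g := grammar) I s, w = x.map .letter ++ v := by
  induction x generalizing w with
  | nil => exact ⟨w, h, rfl⟩
  | cons c x ih =>
    obtain ⟨_, hv, rfl⟩ := mem_singleton_mul.1 h
    obtain ⟨v, hv', rfl⟩ := ih hv
    exact ⟨v, hv', rfl⟩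

theorem interpret_rule_le (r : ContextFreeRule HAlphabet LhNT) (hr : r ∈ grammar.rules) :
    ContextFreeGrammar.interpret (g := grammar) lang r.output ≤ lang r.input := by
  intro w hw
  replace hr : r ∈ ruleList := List.mem_toFinset.1 hr
  simp only [ruleList, List.mem_append, List.mem_map, List.mem_cons,
    List.not_mem_nil, or_false, List.mem_finRange, true_and, or_assoc] at hr
  rcases hr with rfl | rfl | rfl | rfl | rfl | rfl | rfl | rfl | ⟨c, -, rfl⟩ | ⟨c, -, rfl⟩ | ⟨i, rfl⟩
  · simp only [ContextFreeGrammar.interpret, mul_one] at hw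
    exact Or.inl hw
  · simp only [ContextFreeGrammar.interpret, mul_one] at hw
    exact Or.inr hw
  · simp only [ContextFreeGrammar.interpret, mul_one] at hw
    obtain ⟨v, hv, rfl⟩ := mem_singleton_mul.1 hw
    rcases hv with hv | ⟨v, m, hv, hm, rfl⟩
    · exact ⟨[], v, by simp, hv, rfl⟩
    · exact ⟨.dollar :: v, m, by simpa [HAlphabet.IsBlock] using hv, hm, rfl⟩
  · simp only [ContextFreeGrammar.interpret, mul_one] at hw
    exact ⟨[], w, hw, by simp [hHom]⟩
  · simp only [ContextFreeGrammar.interpret, mul_one] at hw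
    exact Or.inl hw
  · simp only [ContextFreeGrammar.interpret, mul_one] at hw
    obtain ⟨v, hv, rfl⟩ := mem_singleton_mul.1 hw
    exact Or.inr ⟨v, hv, rfl⟩
  · simp only [ContextFreeGrammar.interpret, mul_one] at hw
    exact ⟨[], by simp, hw⟩
  · simp only [ContextFreeGrammar.interpret, mul_one] at hw
    obtain ⟨_, ⟨v, hv, rfl⟩, rfl⟩ := mem_singleton_mul.1 hw
    exact ⟨.dollar :: v, by simpa [HAlphabet.IsBlock] using hv, rfl⟩
  · simp only [ContextFreeGrammar.interpret, mul_one] at hw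
    obtain ⟨_, ⟨v, m, hv, hm, rfl⟩, rfl⟩ := mem_singleton_mul.1 hw
    exact ⟨.letter c :: v, m, by simpa [HAlphabet.IsBlock] using hv, hm, rfl⟩
  · simp only [ContextFreeGrammar.interpret, mul_one] at hw
    obtain ⟨_, ⟨v, hv, rfl⟩, rfl⟩ := mem_singleton_mul.1 hw
    exact ⟨.letter c :: v, by simpa [HAlphabet.IsBlock] using hv, rfl⟩
  · obtain ⟨v, hv, rfl⟩ := interpret_terminals _ _ hw
    simp only [ContextFreeGrammar.interpret, mul_one] at hv
    obtain ⟨_, ⟨y, n, hn, rfl⟩, _, rfl, rfl⟩ := Language.mem_mul.1 hv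
    exact ⟨y ++ [i], n, hn, by simp [hHom_concat]⟩

/-- `A.Yields w`: the grammar derives the word `w` from `A`. -/
abbrev Yields (A : LhNT) (w : List HAlphabet) : Prop :=
  grammar.Derives [.nonterminal A] (w.map .terminal)

theorem Yields.of_rule {A : LhNT} {s : List (Symbol HAlphabet LhNT)} (h : ⟨A, s⟩ ∈ ruleList)
    {w : List HAlphabet} (hw : grammar.Derives s (w.map .terminal)) : A.Yields w :=
  Relation.ReflTransGen.head
    ⟨⟨A, s⟩, List.mem_toFinset.2 h, ContextFreeRule.Rewrites.input_output⟩ hw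

theorem Yields.of_cons {A B : LhNT} {t : HAlphabet}
    (h : ⟨A, [.terminal t, .nonterminal B]⟩ ∈ ruleList) {w : List HAlphabet}
    (hw : B.Yields w) : A.Yields (t :: w) :=
  .of_rule h (ContextFreeGrammar.Derives.append_left hw [.terminal t])

theorem mem_pair (i : AB) : i ∈ [AB.a, AB.b] := by cases i <;> simp

theorem yields_tail {w : List HAlphabet} (h : w ∈ lang tail) : tail.Yields w := by
  obtain ⟨v, hv, rfl⟩ := h
  induction v with
  | nil => exact .of_rule (s := [.terminal .border]) (by simp [ruleList]) Relation.ReflTransGen.refl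
  | cons s v ih =>
    have ih := ih fun s hs => hv s (by simp [hs])
    have hs := hv s (by simp)
    cases s with
    | letter c => exact .of_cons (by simpa [ruleList] using mem_pair c) ih
    | dollar => exact .of_cons (by simp [ruleList]) ih
    | border => exact hs.elim
    | alpha i => exact hs.elim

theorem yields_mid {w : List HAlphabet} (h : w ∈ lang mid) : mid.Yields w := by
  rcases h with rfl | ⟨v, hv, rfl⟩
  · exact .of_rule (s := [.terminal .border]) (by simp [ruleList]) Relation.ReflTransGen.refl
  · exact .of_cons (by simp [ruleList]) (yields_tail hv)

theorem yields_pair {w : List HAlphabet} (h : w ∈ lang pair) : pair.Yields w := by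
  obtain ⟨y, n, hn, rfl⟩ := h
  -- As `x` is the reversal of `h(y)`, the last letter of `y` matches the first two letters of `x`;
  -- this is the outermost pair of the nesting.
  induction y using List.reverseRecOn with
  | nil => exact .of_rule (s := [.nonterminal mid]) (by simp [ruleList]) (by
      simpa [hHom] using yields_mid hn)
  | append_singleton y i ih =>
    refine .of_rule (s := (hLetter i).reverse.map (fun c => .terminal (.letter c)) ++
      [.nonterminal pair, .terminal (.alpha i)]) (by simp [ruleList]) ?_
    have := (ContextFreeGrammar.Derives.append_right ih [.terminal (.alpha i)]).append_left
      ((hLetter i).reverse.map (fun c => .terminal (.letter c)))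
    simpa [hHom_concat, Function.comp_def] using this

theorem yields_start {w : List HAlphabet} (h : w ∈ lang pair) : start.Yields w :=
  .of_rule (s := [.nonterminal pair]) (by simp [ruleList]) (yields_pair h)

theorem yields_skip {w : List HAlphabet} (h : w ∈ lang skip) : skip.Yields w := by
  obtain ⟨v, m, hv, hm, rfl⟩ := h
  induction v with
  | nil => exact .of_cons (by simp [ruleList]) (yields_start hm)
  | cons s v ih =>
    have ih := ih fun s hs => hv s (by simp [hs])
    have hs := hv s (by simp)
    cases s with
    | letter c => exact .of_cons (by simpa [ruleList] using mem_pair c) ih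
    | dollar =>
      exact Yields.of_cons (A := skip) (B := start) (by simp [ruleList])
        (Yields.of_rule (s := [.nonterminal skip]) (by simp [ruleList]) ih)
    | border => exact hs.elim
    | alpha i => exact hs.elim

theorem language_grammar : grammar.language = lang start := by
  apply le_antisymm
  · intro w hw
    obtain ⟨n, hn⟩ := ContextFreeGrammar.mem_language_iff_parses.1 hw
    have := hn.mem_interpret (I := lang) interpret_rule_le
    simp only [ContextFreeGrammar.interpret, mul_one] at this
    exact this
  · rintro w (h | h)
    · exact yields_start h
    · exact Yields.of_rule (A := start) (s := [.nonterminal skip]) (by simp [ruleList]) (yields_skip h)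

theorem mem_lang_mid {w : List HAlphabet} :
    w ∈ lang mid ↔ w = [.border] ∨ ∃ xs, xs ≠ [] ∧ w = .dollar :: (blocks xs ++ [.border]) := by
  constructor
  · rintro (rfl | ⟨_, ⟨v, hv, rfl⟩, rfl⟩)
    · exact Or.inl rfl
    · obtain ⟨xs, hxs, rfl⟩ := exists_eq_blocks hv
      exact Or.inr ⟨xs, hxs, rfl⟩
  · rintro (rfl | ⟨xs, hxs, rfl⟩)
    · exact Or.inl rfl
    · exact Or.inr ⟨_, ⟨_, fun s hs => isBlock_of_mem_blocks hs, rfl⟩, rfl⟩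

theorem mem_lang_pair {w : List HAlphabet} :
    w ∈ lang pair ↔ ∃ (x : List AB) (xs : List (List AB)) (y : List (Fin 4)),
      x.reverse = hHom y ∧ w = blocks (x :: xs) ++ [.border] ++ y.map .alpha := by
  constructor
  · rintro ⟨y, n, hn, rfl⟩
    rcases mem_lang_mid.1 hn with rfl | ⟨xs, hxs, rfl⟩
    · exact ⟨(hHom y).reverse, [], y, by simp, by simp [blocks_singleton]⟩
    · refine ⟨(hHom y).reverse, xs, y, by simp, ?_⟩
      simp [blocks_cons _ hxs]
  · rintro ⟨x, xs, y, hx, rfl⟩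
    rcases eq_or_ne xs [] with rfl | hxs
    · exact ⟨y, [.border], Or.inl rfl, by simp [← hx, blocks_singleton]⟩
    · refine ⟨y, _, mem_lang_mid.2 (Or.inr ⟨xs, hxs, rfl⟩), ?_⟩
      simp [← hx, blocks_cons _ hxs]

theorem lang_start : lang start = Lh := by
  ext w
  constructor
  · rintro (h | ⟨v, m, hv, hm, rfl⟩)
    · obtain ⟨x, xs, y, hx, rfl⟩ := mem_lang_pair.1 h
      exact ⟨x :: xs, y, ⟨x, by simp, hx⟩, rfl⟩
    · obtain ⟨x, xs, y, hx, rfl⟩ := mem_lang_pair.1 hm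
      obtain ⟨zs, hzs, rfl⟩ := exists_eq_blocks hv
      refine ⟨zs ++ x :: xs, y, ⟨x, by simp, hx⟩, ?_⟩
      change _ = blocks _ ++ _ ++ _
      rw [blocks_append hzs (by simp)]
      simp
  · rintro ⟨l, y, ⟨x, hx, hxy⟩, rfl⟩
    obtain ⟨zs, xs, rfl⟩ := List.append_of_mem hx
    change blocks _ ++ _ ++ _ ∈ _
    rcases eq_or_ne zs [] with rfl | hzs
    · exact Or.inl (mem_lang_pair.2 ⟨x, xs, y, hxy, rfl⟩)
    · refine Or.inr ⟨blocks zs, _, fun s hs => isBlock_of_mem_blocks hs,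
        mem_lang_pair.2 ⟨x, xs, y, hxy, rfl⟩, ?_⟩
      rw [blocks_append hzs (by simp)]
      simp

end LhNT

theorem isContextFree_Lh : Lh.IsContextFree :=
  ⟨LhNT.grammar, LhNT.language_grammar.trans LhNT.lang_start⟩
/-! ### Computations in real time -/

namespace GammaTree

variable {Γ : Type}

@[ext]
theorem ext {T T' : GammaTree Γ} (h : T.label = T'.label) : T = T' := by
  cases T
  cases T'
  cases h
  rfl

/-- The tree `T` with a new `d`-descendant of the node `P` that is labelled by `x`. -/
def push (T : GammaTree Γ) (P : Node) (hP : T.label P ≠ none) (d : Side) (x : Γ) :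
    GammaTree Γ where
  label := Function.update T.label (d :: P) (some (x : WithBot Γ))
  finite_nodes := (T.finite_nodes.insert (d :: P)).subset fun w hw => by
    by_cases h : w = d :: P
    · exact Or.inl h
    · exact Or.inr (by simpa [Function.update_of_ne h] using hw)
  prefix_closed e w h := by
    by_cases hw : w = d :: P
    · simp [hw]
    · rw [Function.update_of_ne hw]
      by_cases hew : e :: w = d :: P
      · obtain ⟨-, rfl⟩ := List.cons.inj hew
        exact hP
      · rw [Function.update_of_ne hew] at h
        exact T.prefix_closed e w h
  label_eq_bot_iff w := by
    by_cases hw : w = d :: P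
    · simp [hw]
    · rw [Function.update_of_ne hw]
      exact T.label_eq_bot_iff w

/-- The tree `T` without the leaf `P`. -/
def pop (T : GammaTree Γ) (P : Node) (hP : P ≠ []) (h : ∀ d, T.label (d :: P) = none) :
    GammaTree Γ where
  label := Function.update T.label P none
  finite_nodes := T.finite_nodes.subset fun w hw => by
    by_cases h : w = P
    · simp [h] at hw
    · simpa [Function.update_of_ne h] using hw
  prefix_closed e w hew := by
    have hew' : T.label (e :: w) ≠ none := by
      by_cases heq : e :: w = P
      · simp [heq] at hew
      · rwa [Function.update_of_ne heq] at hew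
    by_cases hw : w = P
    · exact absurd (h e) (by rwa [← hw])
    · rw [Function.update_of_ne hw]
      exact T.prefix_closed e w hew'
  label_eq_bot_iff w := by
    by_cases hw : w = P
    · simp [hw, hP]
    · rw [Function.update_of_ne hw]
      exact T.label_eq_bot_iff w

end GammaTree

theorem StorageOp.Performs.unique {Γ : Type} {op : StorageOp Γ} {T T₁ T₂ : GammaTree Γ}
    {P P₁ P₂ : Node} (h₁ : op.Performs T P T₁ P₁) (h₂ : op.Performs T P T₂ P₂) :
    T₁ = T₂ ∧ P₁ = P₂ := by
  cases op with
  | up =>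
    obtain ⟨⟨d, rfl⟩, rfl⟩ := h₁
    obtain ⟨⟨e, h⟩, rfl⟩ := h₂
    exact ⟨rfl, (List.cons.inj h).2⟩
  | stay => exact ⟨h₁.2.trans h₂.2.symm, h₁.1.trans h₂.1.symm⟩
  | down d => exact ⟨h₁.2.2.trans h₂.2.2.symm, h₁.1.trans h₂.1.symm⟩
  | pop =>
    obtain ⟨⟨d, rfl⟩, -, -, h₁⟩ := h₁
    obtain ⟨⟨e, h⟩, -, -, h₂⟩ := h₂
    exact ⟨GammaTree.ext (h₁.trans h₂.symm), (List.cons.inj h).2⟩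
  | push x d => exact ⟨GammaTree.ext (h₁.2.2.trans h₂.2.2.symm), h₁.1.trans h₂.1.symm⟩

namespace TWSDA

variable {A : Type} {M : TWSDA A}

/-- A configuration without the input. -/
structure Snapshot (M : TWSDA A) where
  state : M.Q
  tree : GammaTree M.Γ
  pointer : Node

/-- The snapshot at the beginning of a computation. -/
def initial (M : TWSDA A) : M.Snapshot := ⟨M.start, GammaTree.single M.Γ, []⟩

/-- The automaton moves from `s` to `t` when it reads `a`. -/
def Move (M : TWSDA A) (a : TapeSymbol A) (s t : M.Snapshot) : Prop :=
  ∃ (x : WithBot M.Γ) (op : StorageOp M.Γ), s.tree.label s.pointer = some x ∧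
    M.δ s.state (some a) (s.tree.typeAt s.pointer) x = some (t.state, op) ∧
    op.Performs s.tree s.pointer t.tree t.pointer

theorem Move.unique {a : TapeSymbol A} {s t t' : M.Snapshot} (h : M.Move a s t)
    (h' : M.Move a s t') : t = t' := by
  obtain ⟨x, op, hx, hδ, hp⟩ := h
  obtain ⟨x', op', hx', hδ', hp'⟩ := h'
  obtain rfl : x = x' := Option.some.inj (hx.symm.trans hx')
  rw [hδ, Option.some.injEq, Prod.mk.injEq] at hδ'
  obtain ⟨hs, rfl⟩ := hδ'
  obtain ⟨hT, hP⟩ := hp.unique hp'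
  cases t
  cases t'
  simp_all

/-- The automaton moves from `s` to `t` when it reads the word. -/
def Moves (M : TWSDA A) : List (TapeSymbol A) → M.Snapshot → M.Snapshot → Prop
  | [], s, t => s = t
  | a :: v, s, t => ∃ s', M.Move a s s' ∧ Moves M v s' t

theorem moves_append {u v : List (TapeSymbol A)} {s t : M.Snapshot} :
    M.Moves (u ++ v) s t ↔ ∃ s', M.Moves u s s' ∧ M.Moves v s' t := by
  induction u generalizing s with
  | nil => simp [Moves]
  | cons a u ih =>
    simp only [List.cons_append, Moves, ih]
    constructor
    · rintro ⟨s₁, h₁, s₂, h₂, h₃⟩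
      exact ⟨s₂, ⟨s₁, h₁, h₂⟩, h₃⟩
    · rintro ⟨s₂, ⟨s₁, h₁, h₂⟩, h₃⟩
      exact ⟨s₁, h₁, s₂, h₂, h₃⟩

theorem Moves.unique {u : List (TapeSymbol A)} {s t t' : M.Snapshot} (h : M.Moves u s t)
    (h' : M.Moves u s t') : t = t' := by
  induction u generalizing s with
  | nil => exact Eq.trans (Eq.symm h) h'
  | cons a u ih =>
    obtain ⟨s₁, h₁, h⟩ := h
    obtain ⟨s₂, h₂, h'⟩ := h'
    obtain rfl := h₁.unique h₂
    exact ih h h'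

/-- A configuration without its input. -/
def Config.snapshot (c : M.Config) : M.Snapshot := ⟨c.state, c.tree, c.pointer⟩

theorem RealTime.step_iff (hM : M.RealTime) {c c' : M.Config} :
    M.Step c c' ↔ ∃ a, c.unread = a :: c'.unread ∧ M.Move a c.snapshot c'.snapshot := by
  constructor
  · rintro ⟨a, x, op, hu, hx, hδ, hp⟩
    cases a with
    | none => rw [hM] at hδ; cases hδ
    | some a => exact ⟨a, hu, x, op, hx, hδ, hp⟩
  · rintro ⟨a, hu, x, op, hx, hδ, hp⟩
    exact ⟨some a, x, op, hu, hx, hδ, hp⟩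

theorem RealTime.moves_of_reflTransGen (hM : M.RealTime) {c c' : M.Config}
    (h : Relation.ReflTransGen M.Step c c') (hc' : c'.unread = []) :
    M.Moves c.unread c.snapshot c'.snapshot := by
  induction h using Relation.ReflTransGen.head_induction_on with
  | refl => rw [hc']; rfl
  | head h _ ih =>
    obtain ⟨a, hu, hm⟩ := hM.step_iff.1 h
    rw [hu]
    exact ⟨_, hm, ih⟩

theorem RealTime.reflTransGen_of_moves (hM : M.RealTime) {u : List (TapeSymbol A)}
    {s t : M.Snapshot} (h : M.Moves u s t) :
    Relation.ReflTransGen M.Step ⟨s.state, u, s.tree, s.pointer⟩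
      ⟨t.state, [], t.tree, t.pointer⟩ := by
  induction u generalizing s with
  | nil => cases h; exact .refl
  | cons a u ih =>
    obtain ⟨s', h', h⟩ := h
    exact .head (hM.step_iff (c' := ⟨s'.state, u, s'.tree, s'.pointer⟩).2 ⟨a, rfl, h'⟩) (ih h)

theorem RealTime.accepts_iff (hM : M.RealTime) {w : List A} :
    M.Accepts w ↔ ∃ t, M.Moves (w.map .sym ++ [.endmarker]) M.initial t ∧
      t.state ∈ M.accepting := by
  constructor
  · rintro ⟨c, hc, -, hu, hacc⟩
    exact ⟨c.snapshot, hM.moves_of_reflTransGen hc hu, hacc⟩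
  · rintro ⟨t, ht, hacc⟩
    refine ⟨_, hM.reflTransGen_of_moves ht, fun a v x hu _ => ?_, rfl, hacc⟩
    cases a with
    | none => exact hM _ _ _
    | some a => cases hu

/-! ### Local views -/

/-- Two snapshots agree at all nodes that can be reached in `r` steps. -/
structure Agree (r : ℕ) (s t : M.Snapshot) : Prop where
  state : s.state = t.state
  take : s.pointer.take r = t.pointer.take r
  label : ∀ k ≤ r, ∀ w : Node, w.length ≤ r →
    s.tree.label (w ++ s.pointer.drop k) = t.tree.label (w ++ t.pointer.drop k)

theorem append_drop_eq_self_iff (w P : Node) (k : ℕ) : w ++ P.drop k = P ↔ w = P.take k := by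
  conv_lhs => rhs; rw [← List.take_append_drop k P]
  exact List.append_left_inj _

theorem take_eq_of_le {P P' : Node} {r k : ℕ} (h : P.take r = P'.take r) (hk : k ≤ r) :
    P.take k = P'.take k := by
  rw [← min_eq_left hk, ← List.take_take, h, List.take_take]

/-- A relative address hits the pointer in both trees or in neither, since this depends only on the
last `k` turns of the path to the pointer. Hence a local change preserves agreement. -/
theorem update_append_drop {Γ : Type} {f f' : Node → Option (WithBot Γ)} {P P' : Node} {r k : ℕ}
    {y : Option (WithBot Γ)} (h : P.take r = P'.take r) (hk : k ≤ r) {w : Node}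
    (hf : f (w ++ P.drop k) = f' (w ++ P'.drop k)) :
    Function.update f P y (w ++ P.drop k) = Function.update f' P' y (w ++ P'.drop k) := by
  simp only [Function.update_apply, append_drop_eq_self_iff, take_eq_of_le h hk, hf]

/-- Recentres the neighbourhood at a descendant: going up zero levels from there means appending one
more turn `d` at the old pointer, and going up `k + 1` levels means going up `k` from the old one.
-/
theorem Agree.label_cons {r : ℕ} {s t : M.Snapshot} (h : Agree (r + 1) s t) (d : Side) {k : ℕ}
    (hk : k ≤ r) {w : Node} (hw : w.length ≤ r) :
    s.tree.label (w ++ (d :: s.pointer).drop k) = t.tree.label (w ++ (d :: t.pointer).drop k) := by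
  cases k with
  | zero => simpa using h.label 0 (by omega) (w ++ [d]) (by simpa using hw)
  | succ k => exact h.label k (by omega) w (by omega)

/-- One step inspects only the label of the node, its position and the presence of its descendants,
all of which lie within radius one; the pointer moves by at most one edge, which costs one unit of
radius. -/
theorem Agree.move {r : ℕ} {a : TapeSymbol A} {s t s' : M.Snapshot} (h : Agree (r + 1) s t)
    (hs : M.Move a s s') : ∃ t', M.Move a t t' ∧ Agree r s' t' := by
  obtain ⟨x, op, hx, hδ, hp⟩ := hs
  have hx' : t.tree.label t.pointer = some x := by
    rw [← hx]
    exact (h.label 0 (by omega) [] (by simp)).symm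
  have hchild (d : Side) : s.tree.label (d :: s.pointer) = t.tree.label (d :: t.pointer) :=
    h.label 0 (by omega) [d] (by simp)
  have htype : s.tree.typeAt s.pointer = t.tree.typeAt t.pointer := by
    have := congrArg List.head? h.take
    simp only [List.head?_take, Nat.add_eq_zero_iff, one_ne_zero, and_false, if_false] at this
    simp [GammaTree.typeAt, hchild, this]
  rw [h.state, htype] at hδ
  cases op with
  | up =>
    obtain ⟨⟨d, hd⟩, hT⟩ := hp
    have htake := h.take
    rw [hd] at htake
    cases hP : t.pointer with
    | nil => simp [hP] at htake
    | cons e P =>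
      rw [hP] at htake
      simp only [List.take_succ_cons, List.cons.injEq] at htake
      refine ⟨⟨s'.state, t.tree, P⟩, ⟨x, .up, hx', hδ, ⟨e, hP⟩, rfl⟩, rfl, htake.2,
        fun k hk w hw => ?_⟩
      have := h.label (k + 1) (by omega) w (by omega)
      rw [hT]
      simpa [hd, hP] using this
  | stay =>
    obtain ⟨hP, hT⟩ := hp
    refine ⟨⟨s'.state, t.tree, t.pointer⟩, ⟨x, .stay, hx', hδ, rfl, rfl⟩, rfl, ?_,
      fun k hk w hw => ?_⟩
    · rw [hP]
      exact take_eq_of_le h.take (by omega)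
    · rw [hT, hP]
      exact h.label k (by omega) w (by omega)
  | down d =>
    obtain ⟨hP, hne, hT⟩ := hp
    refine ⟨⟨s'.state, t.tree, d :: t.pointer⟩,
      ⟨x, .down d, hx', hδ, rfl, by rwa [← hchild], rfl⟩, rfl, ?_, fun k hk w hw => ?_⟩
    · rw [hP]
      exact take_eq_of_le (r := r + 2) (by simp [h.take]) (by omega)
    · rw [hT, hP]
      exact h.label_cons d hk hw
  | pop =>
    obtain ⟨⟨d, hd⟩, hl, hr, hT⟩ := hp
    have htake := h.take
    rw [hd] at htake
    cases hP : t.pointer with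
    | nil => simp [hP] at htake
    | cons e P =>
      rw [hP] at htake
      have htake' := htake
      simp only [List.take_succ_cons, List.cons.injEq] at htake
      rw [hchild] at hl hr
      refine ⟨⟨s'.state, t.tree.pop t.pointer (by simp [hP]) (fun d => by cases d <;> assumption),
        P⟩, ⟨x, .pop, hx', hδ, ⟨e, hP⟩, hl, hr, rfl⟩, rfl, htake.2, fun k hk w hw => ?_⟩
      have := h.label (k + 1) (by omega) w (by omega)
      have := update_append_drop (y := none) h.take (by omega) this
      rw [hT]
      simpa [hd, hP, GammaTree.pop] using this
  | push y d =>
    obtain ⟨hP, hne, hT⟩ := hp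
    have htake : (d :: s.pointer).take (r + 2) = (d :: t.pointer).take (r + 2) := by simp [h.take]
    refine ⟨⟨s'.state, t.tree.push t.pointer (by simp [hx']) d y, d :: t.pointer⟩,
      ⟨x, .push y d, hx', hδ, rfl, by rwa [← hchild], rfl⟩, rfl, ?_, fun k hk w hw => ?_⟩
    · rw [hP]
      exact take_eq_of_le htake (by omega)
    · rw [hT, hP]
      exact update_append_drop htake (by omega) (h.label_cons d hk hw)

theorem Agree.moves {u : List (TapeSymbol A)} {s t s' : M.Snapshot} (h : Agree u.length s t)
    (hs : M.Moves u s s') : ∃ t', M.Moves u t t' ∧ s'.state = t'.state := by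
  induction u generalizing s t with
  | nil => exact ⟨t, rfl, by rw [← h.state]; exact congrArg _ (Eq.symm hs)⟩
  | cons a u ih =>
    obtain ⟨s₁, h₁, hs⟩ := hs
    obtain ⟨t₁, h₂, h⟩ := Agree.move h h₁
    obtain ⟨t', ht', hst⟩ := ih h hs
    exact ⟨t', ⟨t₁, h₂, ht'⟩, hst⟩

/-- The part of a snapshot that determines the next `r` steps. -/
def view (r : ℕ) (s : M.Snapshot) : M.Q × (Fin r → Option Side) ×
    (Fin (r + 1) × Fin (r + 1) × (Fin r → Side) → Option (WithBot M.Γ)) :=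
  (s.state, fun i => s.pointer[(i : ℕ)]?,
    fun z => s.tree.label ((List.ofFn z.2.2).take z.2.1 ++ s.pointer.drop z.1))

theorem agree_of_view_eq {r : ℕ} {s t : M.Snapshot} (h : view r s = view r t) : Agree r s t := by
  simp only [view, Prod.mk.injEq] at h
  obtain ⟨h₁, h₂, h₃⟩ := h
  refine ⟨h₁, List.ext_getElem? fun i => ?_, fun k hk w hw => ?_⟩
  · rw [List.getElem?_take, List.getElem?_take]
    split_ifs with hi
    · exact congrFun h₂ ⟨i, hi⟩
    · rfl
  -- A word of length at most `r` is padded with `.left` to length `r`; the recorded length cuts the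
  -- padding off again.
  · have := congrFun h₃ (⟨k, by omega⟩, ⟨w.length, by omega⟩, fun i => w.getD i .left)
    have hw' : (List.ofFn fun i : Fin r => w.getD i Side.left).take w.length = w := by
      apply List.ext_getElem
      · simpa using hw
      · intro i h₁ h₂
        simp [h₂]
    dsimp only at this
    rwa [hw'] at this

end TWSDA
/-! ### `L_h` is not accepted in real time -/

theorem hLetter_injective : Function.Injective hLetter := by
  intro i j h
  fin_cases i <;> fin_cases j <;> simp_all [hLetter]

theorem length_hLetter (i : Fin 4) : (hLetter i).length = 2 := by
  fin_cases i <;> rfl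

theorem hHom_injective : Function.Injective hHom := by
  intro y z h
  induction y generalizing z with
  | nil =>
    cases z with
    | nil => rfl
    | cons j z =>
      have := congrArg List.length h
      simp [hHom, length_hLetter] at this
      omega
  | cons i y ih =>
    cases z with
    | nil =>
      have := congrArg List.length h
      simp [hHom, length_hLetter] at this
    | cons j z =>
      obtain ⟨h₁, h₂⟩ := List.append_inj (s₁ := hLetter i) (s₂ := hLetter j) h
        (by rw [length_hLetter, length_hLetter])
      rw [hLetter_injective h₁, ih h₂]

theorem blocks_injective {xs ys : List (List AB)} (hx : xs ≠ []) (hy : ys ≠ [])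
    (h : blocks xs = blocks ys) : xs = ys := by
  have key (zs : List (List AB)) (hz : zs ≠ []) :
      (blocks zs).splitOn .dollar = zs.map fun x => x.map HAlphabet.letter :=
    List.splitOn_intercalate _ (by simp) (by simpa using hz)
  have hinj : Function.Injective fun x : List AB => x.map HAlphabet.letter :=
    List.map_injective_iff.2 fun _ _ h => HAlphabet.letter.inj h
  have := key xs hx
  rw [h, key ys hy] at this
  exact (List.map_injective_iff.2 hinj this).symm

/-- Nonemptiness matters: `blocks [] = blocks [[]]`, and the single empty block matches the empty
`y`. -/
theorem mem_Lh_iff {xs : List (List AB)} (hxs : xs ≠ []) (y : List (Fin 4)) :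
    blocks xs ++ [.border] ++ y.map .alpha ∈ Lh ↔ ∃ x ∈ xs, x.reverse = hHom y := by
  constructor
  · rintro ⟨zs, z, ⟨x, hx, hxz⟩, h⟩
    change _ = blocks zs ++ _ ++ _ at h
    have hborder (l : List (List AB)) : HAlphabet.border ∉ blocks l :=
      fun h => isBlock_of_mem_blocks h
    have halpha (l : List (Fin 4)) : HAlphabet.border ∉ l.map HAlphabet.alpha := by simp
    rw [List.append_assoc, List.append_assoc, List.singleton_append, List.singleton_append,
      List.append_cons_inj_of_notMem (hborder _) (halpha _)] at h
    obtain ⟨h₁, -, h₂⟩ := h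
    obtain rfl := blocks_injective hxs (List.ne_nil_of_mem hx) h₁
    obtain rfl := List.map_injective_iff.2 (fun _ _ h => HAlphabet.alpha.inj h) h₂
    exact ⟨x, hx, hxz⟩
  · rintro h
    exact ⟨xs, y, h, rfl⟩

/-- The word `x₁ $ ⋯ $ xₖ #` where the `xᵢ` are the empty word and the reversed images of the words
in `S`. -/
noncomputable def codeWord {m : ℕ} (S : Finset (Fin m → Fin 4)) : List HAlphabet :=
  blocks ([] :: S.toList.map fun v => (hHom (List.ofFn v)).reverse) ++ [.border]

/-- The extra empty block is there for this: the automaton accepts after the code word alone, so it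
cannot get stuck while reading it, even for empty `S`. -/
theorem codeWord_mem {m : ℕ} (S : Finset (Fin m → Fin 4)) : codeWord S ∈ Lh := by
  have := (mem_Lh_iff (xs := [] :: S.toList.map fun v => (hHom (List.ofFn v)).reverse)
    (by simp) []).2 ⟨[], by simp, rfl⟩
  simpa [codeWord] using this

theorem codeWord_append_mem_iff {m : ℕ} (hm : 0 < m) (S : Finset (Fin m → Fin 4))
    (v : Fin m → Fin 4) : codeWord S ++ (List.ofFn v).map .alpha ∈ Lh ↔ v ∈ S := by
  rw [codeWord, mem_Lh_iff (by simp)]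
  constructor
  · rintro ⟨x, hx, h⟩
    rcases List.mem_cons.1 hx with rfl | hx
    · have := hHom_injective (a₁ := []) h
      have := congrArg List.length this
      simp at this
      omega
    · obtain ⟨v', hv', rfl⟩ := List.mem_map.1 hx
      rw [List.reverse_reverse] at h
      rw [← List.ofFn_injective (hHom_injective h)]
      exact Finset.mem_toList.1 hv'
  · intro hv
    exact ⟨_, List.mem_cons_of_mem _ (List.mem_map.2 ⟨v, Finset.mem_toList.2 hv, rfl⟩), by simp⟩

/-! ### Counting views against sets of words -/

theorem exists_quadratic_lt_two_pow (c : ℕ) : ∃ m, 0 < m ∧ c * (m + 2) ^ 2 < 2 ^ m := by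
  -- Applied to `n = m + 2`: the factor 4 in the bound absorbs `2 ^ (m + 2) = 4 * 2 ^ m`, and `n ≥
  -- 3` ensures `0 < m`.
  have h := (tendsto_pow_const_div_const_pow_of_one_lt 2 (one_lt_two (α := ℝ))).eventually_lt_const
    (show (0 : ℝ) < 1 / (4 * (c + 1)) by positivity)
  obtain ⟨n, hn, h3⟩ := (h.and (Filter.eventually_ge_atTop 3)).exists
  obtain ⟨m, rfl⟩ := Nat.exists_eq_add_of_le' (show 2 ≤ n by omega)
  refine ⟨m, by omega, ?_⟩
  rw [div_lt_div_iff₀ (by positivity) (by positivity)] at hn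
  have : (c : ℝ) * ((m + 2 : ℕ) : ℝ) ^ 2 < 2 ^ m := by
    rw [pow_add] at hn
    nlinarith [sq_nonneg ((m + 2 : ℕ) : ℝ)]
  exact_mod_cast this

theorem exists_views_lt_two_pow (q g : ℕ) :
    ∃ m, 0 < m ∧ q * (3 ^ (m + 1) * g ^ ((m + 2) * ((m + 2) * 2 ^ (m + 1)))) < 2 ^ 4 ^ m := by
  -- In the exponent of 2, `q` bounds the states, `2 * g` the labels (from `g * 2 ^ (m + 1)`), and
  -- the last 2 comes from `3 ≤ 2 ^ 2`.
  obtain ⟨m, hm, h⟩ := exists_quadratic_lt_two_pow (q + 2 * g + 2)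
  refine ⟨m, hm, ?_⟩
  have hq : q ≤ 2 ^ q := Nat.lt_two_pow_self.le
  have hg : g ≤ 2 ^ g := Nat.lt_two_pow_self.le
  calc q * (3 ^ (m + 1) * g ^ ((m + 2) * ((m + 2) * 2 ^ (m + 1))))
      ≤ 2 ^ q * ((2 ^ 2) ^ (m + 1) * (2 ^ g) ^ ((m + 2) * ((m + 2) * 2 ^ (m + 1)))) := by
        gcongr
        norm_num
    _ = 2 ^ (q + (2 * (m + 1) + g * ((m + 2) * ((m + 2) * 2 ^ (m + 1))))) := by
        rw [← pow_mul, ← pow_mul, ← pow_add, ← pow_add]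
    _ < 2 ^ 4 ^ m := by
        apply Nat.pow_lt_pow_right (by norm_num)
        have h4 : 4 ^ m = 2 ^ m * 2 ^ m := by rw [← mul_pow]; norm_num
        have h1 : 1 ≤ 2 ^ m := Nat.one_le_two_pow
        rw [h4, pow_succ]
        have := Nat.mul_lt_mul_of_pos_right h h1
        refine lt_of_le_of_lt ?_ this
        have h2 : q ≤ q * ((m + 2) ^ 2 * 2 ^ m) := Nat.le_mul_of_pos_right _ (by positivity)
        have h3 : 2 * (m + 1) ≤ 2 * ((m + 2) ^ 2 * 2 ^ m) := by
          have : m + 1 ≤ (m + 2) ^ 2 * 1 := by nlinarith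
          exact Nat.mul_le_mul_left _ (this.trans (Nat.mul_le_mul_left _ h1))
        nlinarith

theorem Side.card_eq : Nat.card Side = 2 := by
  have e : Side ≃ Bool :=
    ⟨fun d => d = .left, fun b => if b then .left else .right, by intro d; cases d <;> rfl, by
      intro b; cases b <;> rfl⟩
  simp [Nat.card_congr e]

instance : Finite Side := Nat.finite_of_card_ne_zero (by rw [Side.card_eq]; norm_num)

namespace TWSDA

theorem exists_card_view_lt {A : Type} (M : TWSDA A) : ∃ m, 0 < m ∧
    Nat.card (M.Q × (Fin (m + 1) → Option Side) ×
      (Fin (m + 1 + 1) × Fin (m + 1 + 1) × (Fin (m + 1) → Side) → Option (WithBot M.Γ))) <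
      2 ^ 4 ^ m := by
  have := M.finite_Q
  have := M.finite_Γ
  obtain ⟨m, hm, h⟩ := exists_views_lt_two_pow (Nat.card M.Q) (Nat.card (Option (WithBot M.Γ)))
  refine ⟨m, hm, ?_⟩
  simpa [Nat.card_prod, Nat.card_fun, Finite.card_option, Side.card_eq] using h

theorem language_ne_Lh {M : TWSDA HAlphabet} (hM : M.RealTime) : M.language ≠ Lh := by
  intro hL
  have acc (w : List HAlphabet) : w ∈ Lh ↔
      ∃ t, M.Moves (w.map .sym ++ [.endmarker]) M.initial t ∧ t.state ∈ M.accepting := by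
    rw [← hL]
    exact hM.accepts_iff
  obtain ⟨m, hm, hcard⟩ := M.exists_card_view_lt
  have hex (S : Finset (Fin m → Fin 4)) :
      ∃ s, M.Moves ((codeWord S).map .sym) M.initial s := by
    obtain ⟨t, ht, -⟩ := (acc _).1 (codeWord_mem S)
    obtain ⟨s, hs, -⟩ := moves_append.1 ht
    exact ⟨s, hs⟩
  choose f hf using hex
  have := M.finite_Q
  have := M.finite_Γ
  obtain ⟨S, S', hne, heq⟩ : ∃ S S', S ≠ S' ∧ view (m + 1) (f S) = view (m + 1) (f S') := by
    have := Fintype.ofFinite (M.Q × (Fin (m + 1) → Option Side) ×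
      (Fin (m + 1 + 1) × Fin (m + 1 + 1) × (Fin (m + 1) → Side) → Option (WithBot M.Γ)))
    apply Fintype.exists_ne_map_eq_of_card_lt fun S => view (m + 1) (f S)
    rw [← Nat.card_eq_fintype_card]
    simpa using hcard
  -- Equal views force the same verdict on every continuation `v`, and the verdict is membership of
  -- `v` in the encoded set.
  have key (S S' : Finset (Fin m → Fin 4)) (heq : view (m + 1) (f S) = view (m + 1) (f S')) :
      S ⊆ S' := by
    intro v hv
    rw [← codeWord_append_mem_iff hm, acc, List.map_append, List.append_assoc] at hv ⊢
    obtain ⟨t, ht, hacc⟩ := hv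
    obtain ⟨s, hs, ht⟩ := moves_append.1 ht
    obtain rfl := hs.unique (hf S)
    -- The endmarker accounts for the radius `m + 1` instead of `m`.
    have hlen : (((List.ofFn v).map HAlphabet.alpha).map TapeSymbol.sym ++
        [TapeSymbol.endmarker]).length = m + 1 := by simp
    obtain ⟨t', ht', hst⟩ := Agree.moves (t := f S') (hlen ▸ agree_of_view_eq heq) ht
    exact ⟨t', moves_append.2 ⟨_, hf S', ht'⟩, hst ▸ hacc⟩
  exact hne ((key S S' heq).antisymm (key S' S heq.symm))

end TWSDA
/-! ### An automaton for `L_fib` -/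

/-- The states of an automaton for `L_fib`: after ten initial steps, it traverses the tree in
rounds. The pointer enters an existing node in state `down` and a new one in state `fresh`;
`back` and `done` say that the left part and the whole of the subtree have been treated. -/
inductive FibState where
  | init (i : Fin 10)
  | down
  | fresh
  | back
  | done
  | wait (i : Fin 3)
  | accept

namespace FibState

instance : Finite FibState :=
  Finite.of_surjective (fun s : (Fin 10 ⊕ Fin 3) ⊕ Fin 5 => match s with
    | .inl (.inl i) => init i
    | .inl (.inr i) => wait i
    | .inr i => ![down, fresh, back, done, accept] i) (by
    intro s
    cases s with
    | init i => exact ⟨.inl (.inl i), rfl⟩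
    | wait i => exact ⟨.inl (.inr i), rfl⟩
    | down => exact ⟨.inr 0, rfl⟩
    | fresh => exact ⟨.inr 1, rfl⟩
    | back => exact ⟨.inr 2, rfl⟩
    | done => exact ⟨.inr 3, rfl⟩
    | accept => exact ⟨.inr 4, rfl⟩)

/-- The state in which the pointer at a node turns to the `d`-descendant. -/
def enter : Side → FibState
  | .left => down
  | .right => back

/-- The state after the treatment of an existing `d`-descendant. -/
def leave : Side → FibState
  | .left => back
  | .right => done

/-- The operation that turns to the `d`-descendant. -/
def visit (d : Side) (t : NodeType) : FibState × StorageOp Unit :=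
  if t.has d = true then (down, .down d) else (fresh, .push () d)

/-- The transition function on input `a`. -/
def step (t : NodeType) : FibState → Option (FibState × StorageOp Unit)
  | init i => some (if h : i.val + 1 < 10 then init ⟨i + 1, h⟩ else down, .stay)
  | down => some (visit .left t)
  | back => some (visit .right t)
  | fresh => t.position.map fun _ => (done, .up)
  | done => some (match t.position with
    | some d => (leave d, .up)
    | none => (wait 0, .stay))
  | wait i => some (if h : i.val + 1 < 3 then wait ⟨i + 1, h⟩ else down, .stay)
  | accept => none

/-- The states that lead to acceptance if the pointer is at the root and the input ends. -/
def Final : FibState → Prop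
  | init i => i.val = 2 ∨ i.val = 4 ∨ i.val = 6
  | down => True
  | _ => False

theorem legal_visit (d : Side) (t : NodeType) : (visit d t).2.Legal t := by
  unfold visit
  split_ifs with h
  · exact h
  · exact eq_false_of_ne_true h

theorem visit_ne_pop (d : Side) (t : NodeType) (q : FibState) : visit d t ≠ (q, .pop) := by
  unfold visit
  split_ifs <;> simp

theorem legal_step {t : NodeType} {q q' : FibState} {op : StorageOp Unit}
    (h : step t q = some (q', op)) : op.Legal t := by
  cases q with
  | init i => obtain ⟨-, rfl⟩ := Prod.mk.inj (Option.some.inj h); trivial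
  | down => have := legal_visit .left t; rwa [Option.some.inj h] at this
  | back => have := legal_visit .right t; rwa [Option.some.inj h] at this
  | fresh =>
    obtain ⟨d, hd, h⟩ := Option.map_eq_some_iff.1 h
    obtain ⟨-, rfl⟩ := Prod.mk.inj h
    simp [StorageOp.Legal, hd]
  | done =>
    cases hd : t.position with
    | none =>
      simp only [step, hd, Option.some.injEq, Prod.mk.injEq] at h
      rw [← h.2]
      trivial
    | some d =>
      simp only [step, hd, Option.some.injEq, Prod.mk.injEq] at h
      rw [← h.2]
      simp [StorageOp.Legal, hd]
  | wait i => obtain ⟨-, rfl⟩ := Prod.mk.inj (Option.some.inj h); trivial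
  | accept => cases h

theorem step_ne_pop {t : NodeType} {q q' : FibState} : step t q ≠ some (q', .pop) := by
  intro h
  cases q with
  | down => exact visit_ne_pop _ _ _ (Option.some.inj h)
  | back => exact visit_ne_pop _ _ _ (Option.some.inj h)
  | fresh =>
    obtain ⟨d, hd, h⟩ := Option.map_eq_some_iff.1 h
    cases (Prod.mk.inj h).2
  | done =>
    cases hd : t.position <;> simp [step, hd] at h
  | init i => cases (Prod.mk.inj (Option.some.inj h)).2
  | wait i => cases (Prod.mk.inj (Option.some.inj h)).2
  | accept => cases h

end FibState

open FibState

open Classical in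
/-- An automaton for `L_fib`. -/
noncomputable def fibMachine : TWSDA Unit where
  Q := FibState
  Γ := Unit
  finite_Q := inferInstance
  finite_Γ := inferInstance
  δ q a t _ := match a with
    | none => none
    | some (.sym _) => step t q
    | some .endmarker => if q.Final ∧ t.position = none then some (accept, .stay) else none
  start := init 0
  accepting := {accept}
  no_choice _ _ _ h := absurd rfl h
  legal q a t x q' op h := by
    match a, h with
    | some (.sym _), h => exact legal_step h
    | some .endmarker, h =>
      simp only [Option.ite_none_right_eq_some, Option.some.injEq, Prod.mk.injEq] at h
      rw [← h.2.2]
      trivial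

namespace fibMachine

theorem realTime : fibMachine.RealTime := fun _ _ _ => rfl

theorem nonErasing : fibMachine.NonErasing := by
  intro q a t x q' h
  match a, h with
  | some (.sym _), h => exact step_ne_pop h
  | some .endmarker, h =>
    simp only [fibMachine, Option.ite_none_right_eq_some, Option.some.injEq] at h
    cases (Prod.mk.inj h.2).2

/-- The snapshots of the automaton. -/
abbrev Snap : Type := fibMachine.Snapshot

/-- The snapshot with the given components. -/
abbrev snap (q : FibState) (T : GammaTree Unit) (P : Node) : Snap := ⟨q, T, P⟩

/-- The nodes of a tree. -/
def nodes (T : GammaTree Unit) : Set Node := {w | T.label w ≠ none}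

/-- The input is accepted if it ends in this snapshot. -/
def Marked (s : Snap) : Prop := FibState.Final s.state ∧ s.pointer = []

/-- The automaton moves from `s` to `t` when it reads an input symbol. -/
abbrev Next (s t : Snap) : Prop := fibMachine.Move (.sym ()) s t

theorem next_of_step {q q' : FibState} {op : StorageOp Unit} {T T' : GammaTree Unit} {P P' : Node}
    (hP : P ∈ nodes T) (h : step (T.typeAt P) q = some (q', op)) (hop : op.Performs T P T' P') :
    Next (snap q T P) (snap q' T' P') := by
  obtain ⟨x, hx⟩ := Option.ne_none_iff_exists'.1 hP
  exact ⟨x, op, hx, h, hop⟩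

theorem has_typeAt (T : GammaTree Unit) (P : Node) (d : Side) :
    (T.typeAt P).has d = true ↔ d :: P ∈ nodes T := by
  cases d <;> simp [NodeType.has, GammaTree.typeAt, nodes, Option.isSome_iff_ne_none]

theorem step_enter (t : NodeType) (d : Side) : step t (enter d) = some (visit d t) := by
  cases d <;> rfl

theorem next_push {T : GammaTree Unit} {P : Node} {d : Side} (hP : P ∈ nodes T)
    (hd : d :: P ∉ nodes T) : ∃ T', nodes T' = insert (d :: P) (nodes T) ∧
      Next (snap (enter d) T P) (snap fresh T' (d :: P)) := by
  refine ⟨T.push P hP d (), ?_, next_of_step hP (op := .push () d) ?_ ⟨rfl, ?_, rfl⟩⟩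
  · ext w
    by_cases hw : w = d :: P
    · simp [nodes, GammaTree.push, hw]
    · simp [nodes, GammaTree.push, hw]
  · rw [step_enter, visit, if_neg (by rwa [has_typeAt])]
  · simpa [nodes] using hd

theorem next_down {T : GammaTree Unit} {P : Node} {d : Side} (hP : P ∈ nodes T)
    (hd : d :: P ∈ nodes T) : Next (snap (enter d) T P) (snap down T (d :: P)) :=
  next_of_step hP (op := .down d)
    (by rw [step_enter, visit, if_pos (by rwa [has_typeAt])]) ⟨rfl, hd, rfl⟩

theorem next_fresh {T : GammaTree Unit} {P : Node} {d : Side} (hd : d :: P ∈ nodes T) :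
    Next (snap fresh T (d :: P)) (snap done T P) :=
  next_of_step hd (op := .up) rfl ⟨⟨d, rfl⟩, rfl⟩

theorem next_done {T : GammaTree Unit} {P : Node} {d : Side} (hd : d :: P ∈ nodes T) :
    Next (snap done T (d :: P)) (snap (leave d) T P) :=
  next_of_step hd (op := .up) rfl ⟨⟨d, rfl⟩, rfl⟩

theorem nil_mem_nodes (T : GammaTree Unit) : [] ∈ nodes T := by
  simp [nodes, (T.label_eq_bot_iff []).2 rfl]

theorem next_stay {q q' : FibState} {T : GammaTree Unit}
    (h : step (T.typeAt []) q = some (q', .stay)) : Next (snap q T []) (snap q' T []) :=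
  next_of_step (nil_mem_nodes T) h ⟨rfl, rfl⟩

/-! ### Runs without marked snapshots -/

/-- The automaton moves from `s` to `t` in `n` steps and through snapshots that are not marked. -/
def Quiet : ℕ → Snap → Snap → Prop
  | 0, s, t => s = t
  | n + 1, s, t => ∃ s', Next s s' ∧ ¬ Marked s' ∧ Quiet n s' t

theorem Quiet.single {s t : Snap} (h : Next s t) (ht : ¬ Marked t) : Quiet 1 s t :=
  ⟨t, h, ht, rfl⟩

theorem Quiet.trans {n m : ℕ} {s t u : Snap} (h₁ : Quiet n s t) (h₂ : Quiet m t u) :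
    Quiet (n + m) s u := by
  induction n generalizing s with
  | zero => cases h₁; simpa using h₂
  | succ n ih =>
    obtain ⟨s', h, hs', h₁⟩ := h₁
    rw [Nat.succ_add]
    exact ⟨s', h, hs', ih h₁⟩

/-- The automaton moves from `s` to `t` in `n` steps. -/
abbrev Steps (n : ℕ) (s t : Snap) : Prop := fibMachine.Moves (List.replicate n (.sym ())) s t

theorem Steps.trans {n m : ℕ} {s t u : Snap} (h₁ : Steps n s t) (h₂ : Steps m t u) :
    Steps (n + m) s u := by
  rw [Steps, List.replicate_add]
  exact TWSDA.moves_append.2 ⟨t, h₁, h₂⟩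

theorem Steps.single {s t : Snap} (h : Next s t) : Steps 1 s t := ⟨t, h, rfl⟩

theorem Quiet.steps {n : ℕ} {s t : Snap} (h : Quiet n s t) : Steps n s t := by
  induction n generalizing s with
  | zero => exact h
  | succ n ih =>
    obtain ⟨s', h, -, h'⟩ := h
    exact ⟨s', h, ih h'⟩

/-- Time zero is excluded because `Quiet` says nothing about its first snapshot, which at the
beginning of a round is marked. -/
theorem Quiet.exists_not_marked {n : ℕ} {s t : Snap} (h : Quiet n s t) {i : ℕ} (hi : 0 < i)
    (hin : i ≤ n) : ∃ u, Steps i s u ∧ ¬ Marked u := by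
  induction n generalizing s i with
  | zero => omega
  | succ n ih =>
    obtain ⟨s', h, hs', h'⟩ := h
    obtain ⟨i, rfl⟩ := Nat.exists_eq_succ_of_ne_zero hi.ne'
    rcases Nat.eq_zero_or_pos i with rfl | hi'
    · exact ⟨s', ⟨s', h, rfl⟩, hs'⟩
    · obtain ⟨u, hu, hum⟩ := ih h' hi' (by omega)
      exact ⟨u, ⟨s', h, hu⟩, hum⟩

/-! ### Growth of the tree and the length of a round -/

/-- The number of rounds between the creation of a node and that of its descendant. -/
def cost : Node → ℕ
  | [] => 0
  | .left :: w => cost w + 1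
  | .right :: w => cost w + 2

/-- The number of rounds between the creation of a node and that of its `d`-descendant. -/
def delay : Side → ℕ
  | .left => 1
  | .right => 2

theorem cost_concat (w : Node) (d : Side) : cost (w ++ [d]) = cost w + delay d := by
  induction w with
  | nil => cases d <;> rfl
  | cons e w ih => cases e <;> simp only [List.cons_append, cost, ih] <;> omega

theorem cost_eq_zero {w : Node} : cost w = 0 ↔ w = [] := by
  cases w with
  | nil => simp [cost]
  | cons d w => cases d <;> simp [cost]

/-- The nodes below `P` that have been created within `k` rounds after the creation of `P`. -/
def below (P : Node) (k : ℕ) : Set Node := {v | ∃ w, v = w ++ P ∧ cost w ≤ k}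

theorem append_mem_below {P w : Node} {k : ℕ} : w ++ P ∈ below P k ↔ cost w ≤ k := by
  constructor
  · rintro ⟨v, hv, h⟩
    rwa [List.append_cancel_right hv]
  · exact fun h => ⟨w, rfl, h⟩

theorem append_not_mem_below {P w : Node} {d e : Side} (hde : d ≠ e) {k : ℕ} :
    w ++ d :: P ∉ below (e :: P) k := by
  rintro ⟨v, hv, -⟩
  have := List.append_inj_right' hv rfl
  exact hde (List.cons.inj this).1

theorem below_zero (P : Node) : below P 0 = {P} := by
  ext v
  simp [below, cost_eq_zero]

theorem below_succ_zero (P : Node) : below P 1 = {P} ∪ below (.left :: P) 0 := by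
  ext v
  rw [below_zero]
  constructor
  · rintro ⟨w, rfl, h⟩
    rcases List.eq_nil_or_concat w with rfl | ⟨w, d, rfl⟩
    · exact Or.inl rfl
    · rw [List.concat_eq_append, cost_concat] at h
      cases d
      · have : w = [] := cost_eq_zero.1 (by simpa [delay] using h)
        simp [this]
      · simp [delay] at h
  · rintro (rfl | rfl)
    · exact ⟨[], rfl, by simp [cost]⟩
    · exact ⟨[.left], rfl, by simp [cost]⟩

/-- The Fibonacci recursion at the level of trees: the left subtree starts one round after `P`, the
right one two rounds after. -/
theorem below_succ_succ (P : Node) (k : ℕ) :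
    below P (k + 2) = {P} ∪ below (.left :: P) (k + 1) ∪ below (.right :: P) k := by
  ext v
  constructor
  · rintro ⟨w, rfl, h⟩
    rcases List.eq_nil_or_concat w with rfl | ⟨w, d, rfl⟩
    · exact Or.inl (Or.inl rfl)
    · rw [List.concat_eq_append, cost_concat] at h
      cases d
      · exact Or.inl (Or.inr ⟨w, by simp, by simpa [delay] using h⟩)
      · exact Or.inr ⟨w, by simp, by simpa [delay] using h⟩
  · rintro ((rfl | ⟨w, rfl, h⟩) | ⟨w, rfl, h⟩)
    · exact ⟨[], rfl, by simp [cost]⟩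
    · exact ⟨w ++ [.left], by simp, by rw [cost_concat, delay]; omega⟩
    · exact ⟨w ++ [.right], by simp, by rw [cost_concat, delay]; omega⟩

/-- The traversal of a subtree that has grown for `k` rounds. -/
def Traverses (k : ℕ) : Prop := ∀ (T : GammaTree Unit) (P : Node),
  (∀ w, w ++ P ∈ nodes T ↔ cost w ≤ k) → ∃ T', nodes T' = nodes T ∪ below P (k + 1) ∧
    Quiet (2 * Nat.fib (k + 4) - 4) (snap down T P) (snap done T' P)

/-- The traversal of the `d`-descendant that is to be created if `k = 0`. -/
def Visits (k : ℕ) : Prop := ∀ (d : Side) (T : GammaTree Unit) (P : Node), P ∈ nodes T →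
  (∀ w, w ++ d :: P ∈ nodes T ↔ cost w < k) → ∃ T', nodes T' = nodes T ∪ below (d :: P) k ∧
    Quiet (2 * Nat.fib (k + 3) - 2) (snap (enter d) T P)
      (snap (if k = 0 then done else leave d) T' P)

theorem not_marked_cons {q : FibState} {T : GammaTree Unit} {P : Node} {d : Side} :
    ¬ Marked (snap q T (d :: P)) := by simp [Marked]

theorem not_marked_done {T : GammaTree Unit} {P : Node} : ¬ Marked (snap done T P) :=
  fun h => h.1

theorem not_marked_leave {T : GammaTree Unit} {P : Node} {d : Side} :
    ¬ Marked (snap (leave d) T P) := by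
  cases d <;> exact fun h => h.1

theorem not_marked_wait {T : GammaTree Unit} {P : Node} {i : Fin 3} :
    ¬ Marked (snap (wait i) T P) :=
  fun h => h.1

/-- After a push the pointer returns in state `done` on either side. A node that has just received
its left descendant thus skips its right side until the next round, which is the source of the two
delays. -/
theorem visits_zero : Visits 0 := by
  intro d T P hP h
  obtain ⟨T', hT', hn⟩ := next_push hP (d := d) (by simpa using (h []).not)
  refine ⟨T', ?_, ?_⟩
  · rw [hT', below_zero, Set.union_singleton]
  · exact (Quiet.single hn not_marked_cons).trans
      (.single (next_fresh (by simp [hT'])) not_marked_done)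

/-- Entering and leaving the descendant add two steps, turning the offset `-4` into `-2`. -/
theorem Traverses.visits {k : ℕ} (h : Traverses k) : Visits (k + 1) := by
  intro d T P hP hd
  have hdT : d :: P ∈ nodes T := (hd []).2 (by simp [cost])
  obtain ⟨T', hT', hq⟩ := h T (d :: P) fun w => (hd w).trans Nat.lt_succ_iff
  refine ⟨T', hT', ?_⟩
  have hdT' : d :: P ∈ nodes T' := by rw [hT']; exact Or.inl hdT
  have := ((Quiet.single (next_down hP hdT) not_marked_cons).trans hq).trans
    (.single (next_done hdT') not_marked_leave)
  have h4 : Nat.fib 4 ≤ Nat.fib (k + 4) := Nat.fib_mono (by omega)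
  have h4' : Nat.fib 4 = 3 := rfl
  have heq : 2 * Nat.fib (k + 1 + 3) - 2 = 1 + (2 * Nat.fib (k + 4) - 4) + 1 := by
    rw [show k + 1 + 3 = k + 4 by ring]
    omega
  rw [heq, if_neg (by omega)]
  exact this

/-- With `k = 0` only the left side is visited; otherwise the left visit has parameter `k` and the
right one `k - 1`, and their durations add up by the Fibonacci recursion. -/
theorem traverses_of_visits {k : ℕ} (h : ∀ j ≤ k, Visits j) : Traverses k := by
  intro T P hT
  have hP : P ∈ nodes T := (hT []).2 (by simp [cost])
  have hside (d : Side) (w : Node) : w ++ d :: P ∈ nodes T ↔ cost w + delay d ≤ k := by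
    rw [← cost_concat, ← hT]
    simp
  obtain ⟨T₁, hT₁, hq₁⟩ := h k le_rfl .left T P hP fun w => by rw [hside]; rfl
  cases k with
  | zero =>
    refine ⟨T₁, ?_, hq₁⟩
    rw [hT₁, below_succ_zero, ← Set.union_assoc,
      Set.union_eq_left.2 (show ({P} : Set Node) ⊆ nodes T by simpa using hP)]
  | succ k =>
    have hP₁ : P ∈ nodes T₁ := by rw [hT₁]; exact Or.inl hP
    -- The left visit adds nodes only below the left descendant, so the right subtree is still as in
    -- `T`.
    obtain ⟨T₂, hT₂, hq₂⟩ := h k (by omega) .right T₁ P hP₁ fun w => by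
      rw [hT₁, Set.mem_union, or_iff_left (append_not_mem_below (by simp)), hside]
      simp only [delay]
      omega
    refine ⟨T₂, ?_, ?_⟩
    · rw [hT₂, hT₁, below_succ_succ, ← Set.union_assoc, ← Set.union_assoc,
        Set.union_eq_left.2 (show ({P} : Set Node) ⊆ nodes T by simpa using hP)]
    · rw [if_neg (by omega)] at hq₁
      have hq := Quiet.trans hq₁ hq₂
      have hleave : (if k = 0 then done else leave .right) = done := by split_ifs <;> rfl
      rw [hleave] at hq
      have h3 : Nat.fib 3 ≤ Nat.fib (k + 3) := Nat.fib_mono (by omega)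
      have h3' : Nat.fib 3 = 2 := rfl
      have h4 : Nat.fib 4 ≤ Nat.fib (k + 4) := Nat.fib_mono (by omega)
      have h4' : Nat.fib 4 = 3 := rfl
      have heq : 2 * Nat.fib (k + 1 + 4) - 4 =
          2 * Nat.fib (k + 1 + 3) - 2 + (2 * Nat.fib (k + 3) - 2) := by
        rw [show k + 1 + 4 = k + 3 + 2 by ring, Nat.fib_add_two,
          show k + 1 + 3 = k + 4 by ring, show k + 3 + 1 = k + 4 by ring]
        omega
      rw [heq]
      exact hq

theorem visits (k : ℕ) : Visits k := by
  induction k using Nat.strong_induction_on with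
  | _ k ih =>
    cases k with
    | zero => exact visits_zero
    | succ k => exact (traverses_of_visits fun j hj => ih j (by omega)).visits

theorem exists_round {T : GammaTree Unit} {k : ℕ} (hT : nodes T = below [] k) :
    ∃ T' s, nodes T' = below [] (k + 1) ∧
      Quiet (2 * Nat.fib (k + 4) - 1) (snap down T []) s ∧ Next s (snap down T' []) := by
  obtain ⟨T', hT', hq⟩ := traverses_of_visits (k := k) (fun j _ => visits j) T [] fun w => by
    rw [hT, append_mem_below]
  refine ⟨T', snap (wait 2) T' [], ?_, ?_, next_stay rfl⟩
  · rw [hT', hT, Set.union_eq_right]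
    rintro _ ⟨w, rfl, h⟩
    exact ⟨w, rfl, by omega⟩
  · have h₀ : Next (snap done T' []) (snap (wait 0) T' []) := next_stay rfl
    have h₁ : Next (snap (wait 0) T' []) (snap (wait 1) T' []) := next_stay rfl
    have h₂ : Next (snap (wait 1) T' []) (snap (wait 2) T' []) := next_stay rfl
    have h4 : Nat.fib 4 ≤ Nat.fib (k + 4) := Nat.fib_mono (by omega)
    have h4' : Nat.fib 4 = 3 := rfl
    -- The traversal lasts `2 * Nat.fib (k + 4) - 4` steps; three steps through the waiting states
    -- and the return to `down` fill the round up to `2 * Nat.fib (k + 4)`.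
    have heq : 2 * Nat.fib (k + 4) - 1 = 2 * Nat.fib (k + 4) - 4 + 1 + 1 + 1 := by omega
    rw [heq]
    exact ((hq.trans (.single h₀ not_marked_wait)).trans (.single h₁ not_marked_wait)).trans
      (.single h₂ not_marked_wait)

/-- The snapshot `s` is reached after `n` input symbols. -/
abbrev At (n : ℕ) (s : Snap) : Prop := Steps n fibMachine.initial s

theorem at_init (n : ℕ) (hn : n < 10) : At n (snap (init ⟨n, hn⟩) (GammaTree.single Unit) []) := by
  induction n with
  | zero => rfl
  | succ n ih =>
    refine (ih (by omega)).trans (.single (next_stay ?_))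
    simp [step, hn]

theorem exists_at (k : ℕ) :
    ∃ T, nodes T = below [] k ∧ At (2 * Nat.fib (k + 5)) (snap down T []) := by
  induction k with
  | zero =>
    -- The tenth step ends the initial phase at time `2 * Nat.fib 5`, with the root as the only
    -- node.
    refine ⟨GammaTree.single Unit, ?_, (at_init 9 (by omega)).trans (.single (next_stay ?_))⟩
    · ext w
      simp [nodes, GammaTree.single, below, cost_eq_zero]
    · simp [step]
  | succ k ih =>
    obtain ⟨T, hT, hat⟩ := ih
    obtain ⟨T', s, hT', hq, hn⟩ := exists_round hT
    refine ⟨T', hT', ?_⟩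
    have h4 : Nat.fib 4 ≤ Nat.fib (k + 4) := Nat.fib_mono (by omega)
    have h4' : Nat.fib 4 = 3 := rfl
    have heq : 2 * Nat.fib (k + 1 + 5) = 2 * Nat.fib (k + 5) + (2 * Nat.fib (k + 4) - 1 + 1) := by
      rw [show k + 1 + 5 = k + 4 + 2 by ring, Nat.fib_add_two, show k + 4 + 1 = k + 5 by ring]
      omega
    rw [heq]
    exact hat.trans (hq.steps.trans (.single hn))

theorem exists_fib_le_lt {n : ℕ} (hn : 10 ≤ n) :
    ∃ k, 2 * Nat.fib (k + 5) ≤ n ∧ n < 2 * Nat.fib (k + 6) := by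
  have hex : ∃ k, n < 2 * Nat.fib (k + 6) :=
    ⟨n, by have := Nat.le_fib_add_one (n + 6); omega⟩
  classical
  refine ⟨Nat.find hex, ?_, Nat.find_spec hex⟩
  cases hk : Nat.find hex with
  | zero => simpa [Nat.fib] using hn
  | succ k =>
    have := Nat.find_min hex (m := k) (by omega)
    rw [show k + 1 + 5 = k + 6 by ring]
    omega

theorem exists_marked_iff (n : ℕ) :
    (∃ s, At n s ∧ Marked s) ↔ ∃ i, 1 ≤ i ∧ n = 2 * Nat.fib i := by
  constructor
  · rintro ⟨s, hs, hm⟩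
    by_cases hn : n < 10
    · obtain rfl := hs.unique (at_init n hn)
      rcases hm.1 with h | h | h
      · exact ⟨1, le_rfl, h⟩
      · exact ⟨3, by omega, h⟩
      · exact ⟨4, by omega, h⟩
    · obtain ⟨k, hk, hk'⟩ := exists_fib_le_lt (n := n) (by omega)
      obtain ⟨i, rfl⟩ := Nat.exists_eq_add_of_le hk
      rcases Nat.eq_zero_or_pos i with rfl | hi
      · exact ⟨k + 5, by omega, rfl⟩
      -- Strictly between two starts of rounds the run is quiet, and by determinism its snapshot is
      -- the only one at that time.
      · obtain ⟨T, hT, hat⟩ := exists_at k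
        obtain ⟨T', s', -, hq, -⟩ := exists_round hT
        have hfib : Nat.fib (k + 6) = Nat.fib (k + 4) + Nat.fib (k + 5) := Nat.fib_add_two
        obtain ⟨u, hu, hum⟩ := hq.exists_not_marked hi (by omega)
        obtain rfl := hs.unique (hat.trans hu)
        exact absurd hm hum
  · rintro ⟨i, hi, rfl⟩
    by_cases h5 : i < 5
    · interval_cases i
      · exact ⟨_, at_init 2 (by omega), Or.inl rfl, rfl⟩
      · exact ⟨_, at_init 2 (by omega), Or.inl rfl, rfl⟩
      · exact ⟨_, at_init 4 (by omega), Or.inr (Or.inl rfl), rfl⟩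
      · exact ⟨_, at_init 6 (by omega), Or.inr (Or.inr rfl), rfl⟩
    · obtain ⟨k, rfl⟩ := Nat.exists_eq_add_of_le' (not_lt.1 h5)
      obtain ⟨T, -, hat⟩ := exists_at k
      exact ⟨_, hat, trivial, rfl⟩

theorem exists_move_endmarker_iff (s : Snap) :
    (∃ t, fibMachine.Move .endmarker s t ∧ t.state ∈ fibMachine.accepting) ↔ Marked s := by
  obtain ⟨q, T, P⟩ := s
  constructor
  · rintro ⟨t, ⟨x, op, -, hδ, -⟩, -⟩
    simp only [fibMachine, Option.ite_none_right_eq_some] at hδ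
    exact ⟨hδ.1.1, by simpa [GammaTree.typeAt] using hδ.1.2⟩
  · rintro ⟨hq, hP⟩
    obtain rfl : P = [] := hP
    exact ⟨⟨accept, T, []⟩, ⟨⊥, .stay, (T.label_eq_bot_iff []).2 rfl,
      if_pos ⟨hq, rfl⟩, rfl, rfl⟩, rfl⟩

theorem language_eq : fibMachine.language = Lfib := by
  ext w
  obtain ⟨n, rfl⟩ : ∃ n, w = List.replicate n () := ⟨w.length, List.eq_replicate_length.2 (by simp)⟩
  have h : List.replicate n () ∈ fibMachine.language ↔ ∃ s, At n s ∧ Marked s := by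
    refine realTime.accepts_iff.trans ?_
    simp only [TWSDA.moves_append, List.map_replicate]
    constructor
    · rintro ⟨t, ⟨s, hs, t', hm, rfl⟩, hacc⟩
      exact ⟨s, hs, (exists_move_endmarker_iff s).1 ⟨_, hm, hacc⟩⟩
    · rintro ⟨s, hs, hm⟩
      obtain ⟨t, ht, hacc⟩ := (exists_move_endmarker_iff s).2 hm
      exact ⟨t, ⟨s, hs, t, ht, rfl⟩, hacc⟩
  rw [h, exists_marked_iff]
  refine exists_congr fun i => and_congr_right fun _ => ?_
  rw [List.replicate_left_inj]

end fibMachine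
/-! ### `L_fib` is not context-free -/

theorem fib_progression {c d : ℕ} (hd : 0 < d) :
    ∃ k, ∀ i, 2 * Nat.fib i ≠ c + k * d := by
  -- This makes `Nat.fib N ≥ c + d`: the gap `2 * Nat.fib N` between the doubled Fibonacci numbers
  -- at `N + 1` and `N + 2` exceeds `d`, and subtracting `c` below is not truncated.
  obtain ⟨N, hN⟩ : ∃ N, N = c + d + 1 := ⟨_, rfl⟩
  have hle : N ≤ Nat.fib N + 1 := Nat.le_fib_add_one N
  have hmono : Nat.fib N ≤ Nat.fib (N + 1) := Nat.fib_mono (by omega)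
  have hadd : Nat.fib (N + 2) = Nat.fib N + Nat.fib (N + 1) := Nat.fib_add_two
  -- The first term of the progression beyond `2 * Nat.fib (N + 1)`; it falls into the gap.
  refine ⟨(2 * Nat.fib (N + 1) - c) / d + 1, fun i hi => ?_⟩
  have hdiv := Nat.div_add_mod (2 * Nat.fib (N + 1) - c) d
  have hmod := Nat.mod_lt (2 * Nat.fib (N + 1) - c) hd
  rw [Nat.add_mul _ 1 d, one_mul] at hi
  rw [Nat.mul_comm d] at hdiv
  generalize (2 * Nat.fib (N + 1) - c) / d * d = p at hi hdiv
  generalize (2 * Nat.fib (N + 1) - c) % d = m at hdiv hmod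
  rcases Nat.lt_or_ge i (N + 2) with h | h
  · have := Nat.fib_mono (show i ≤ N + 1 by omega)
    omega
  · have := Nat.fib_mono h
    omega

theorem replicate_mem_Lfib {n : ℕ} :
    List.replicate n () ∈ Lfib ↔ ∃ i, 1 ≤ i ∧ n = 2 * Nat.fib i :=
  exists_congr fun _ => and_congr_right fun _ => List.replicate_left_inj

theorem exists_mem_Lfib_lt_length (b : ℕ) : ∃ w ∈ Lfib, b < w.length := by
  refine ⟨_, ⟨b + 2, by omega, rfl⟩, ?_⟩
  have := Nat.le_fib_add_one (b + 2)
  rw [List.length_replicate]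
  omega

theorem not_isContextFree_Lfib : ¬ Lfib.IsContextFree := by
  intro h
  obtain ⟨c, d, hd, hk⟩ := h.exists_progression exists_mem_Lfib_lt_length
  obtain ⟨k, hne⟩ := fib_progression (c := c) hd
  obtain ⟨w, ⟨i, -, rfl⟩, hw⟩ := hk k
  exact hne i (by simpa using hw)

/-- An infinite semilinear set of natural numbers contains an infinite arithmetic progression. -/
theorem IsSemilinearSet.exists_progression {s : Set ℕ} (hs : IsSemilinearSet s)
    (hinf : s.Infinite) : ∃ c d, 0 < d ∧ ∀ k, c + k * d ∈ s := by
  obtain ⟨S, hS, hlin, rfl⟩ := hs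
  obtain ⟨t, ht, htinf⟩ : ∃ t ∈ S, t.Infinite := by
    by_contra! h
    exact hinf (hS.sUnion fun t ht => h t ht)
  obtain ⟨a, P, -, rfl⟩ := hlin t ht
  -- An infinite linear set has a nonzero period, which is the difference of the progression.
  obtain ⟨p, hp, hp0⟩ : ∃ p ∈ P, p ≠ 0 := by
    by_contra! h
    apply htinf
    have : (AddSubmonoid.closure P : Set ℕ) = {0} := by
      rw [eq_bot_iff.2 (AddSubmonoid.closure_le.2 fun x hx => h x hx), AddSubmonoid.coe_bot]
    rw [this]
    exact (Set.finite_singleton 0).vadd_set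
  refine ⟨a, p, Nat.pos_of_ne_zero hp0, fun k => ⟨_, ht, k * p, ?_, rfl⟩⟩
  simpa using AddSubmonoid.nsmul_mem _ (AddSubmonoid.subset_closure hp) k

theorem not_isSemilinearSet_Lfib : ¬ IsSemilinearSet {n : ℕ | List.replicate n () ∈ Lfib} := by
  intro h
  have hinf : {n : ℕ | List.replicate n () ∈ Lfib}.Infinite := by
    refine Set.infinite_of_not_bddAbove fun ⟨b, hb⟩ => ?_
    obtain ⟨w, hw, hlt⟩ := exists_mem_Lfib_lt_length b
    have hw' : w = List.replicate w.length () := List.eq_replicate_length.2 (by simp)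
    rw [hw'] at hw
    exact absurd (hb hw) (not_le.2 hlt)
  obtain ⟨c, d, hd, hk⟩ := h.exists_progression hinf
  obtain ⟨k, hne⟩ := fib_progression (c := c) hd
  obtain ⟨i, -, hi⟩ := replicate_mem_Lfib.1 (hk k)
  exact hne i hi.symm

/-! ### Incomparability with the context-free languages -/

theorem mainTheorem4 :
    rtTWSDA.Incomparable contextFreeFamily ∧
    rtTWSDNEA.Incomparable contextFreeFamily ∧
    (Lh ∈ contextFreeFamily HAlphabet ∧ Lh ∉ rtTWSDA HAlphabet ∧ Lh ∉ rtTWSDNEA HAlphabet) ∧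
    (Lfib ∈ rtTWSDA Unit ∧ Lfib ∈ rtTWSDNEA Unit ∧
      ¬ IsSemilinearSet {n : ℕ | List.replicate n () ∈ Lfib} ∧
      Lfib ∉ contextFreeFamily Unit) := by
  have h₁ : Lh ∈ contextFreeFamily HAlphabet := isContextFree_Lh
  have h₂ : Lh ∉ rtTWSDA HAlphabet := fun ⟨_, hM, hL⟩ => TWSDA.language_ne_Lh hM hL
  have h₃ : Lh ∉ rtTWSDNEA HAlphabet := fun ⟨_, _, hM, hL⟩ => TWSDA.language_ne_Lh hM hL
  have h₄ : Lfib ∈ rtTWSDA Unit := ⟨fibMachine, fibMachine.realTime, fibMachine.language_eq⟩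
  have h₅ : Lfib ∈ rtTWSDNEA Unit :=
    ⟨fibMachine, fibMachine.nonErasing, fibMachine.realTime, fibMachine.language_eq⟩
  have h₆ : Lfib ∉ contextFreeFamily Unit := not_isContextFree_Lfib
  exact ⟨⟨fun h => h₆ (h Unit h₄), fun h => h₂ (h HAlphabet h₁)⟩,
    ⟨fun h => h₆ (h Unit h₅), fun h => h₃ (h HAlphabet h₁)⟩, ⟨h₁, h₂, h₃⟩,
    h₄, h₅, not_isSemilinearSet_Lfib, h₆⟩
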